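/- Let $n\ge 2$, let $M^n$ be an $n$-dimensional smooth manifold, and let $x:M^n\to\mathbb{R}^{n+1}$ be a locally strongly convex centroaffine hypersurface: a smooth immersion whose position vector is everywhere transversal to the tangent plane and for which a sign $\varepsilon\in\{1,-1\}$ can be, and is, chosen such that the centroaffine metric $h$ in the Gauss formula $$D_Xx_*(Y)=x_*(\nabla_XY)+h(X,Y)(-\varepsilon x)$$ ($D$ the standard flat connection of $\mathbb{R}^{n+1}$) is positive definite. Let $\hat\nabla$ be the Levi-Civita connection of $h$, $K_XY=\nabla_XY-\hat\nabla_XY$ the difference tensor and $C=\nabla h$ the cubic form, and assume that the cubic form is parallel, $\hat\nabla C=0$. Assume that Case $\mathfrak B$ occurs at a point $p\in M^n$: there are an $h$-orthonormal basis $\{e_1,\dots,e_n\}$ of $T_pM^n$ and real numbers $\lambda_1,\dots,\lambda_n$ such that the function $f(u)=h(K_uu,u)$ on the unit sphere $\{u\in T_pM^n: h(u,u)=1\}$ attains its absolute maximum at $e_1$, $K_{e_1}e_i=\lambda_ie_i$ for $i=1,\dots,n$, and $$\lambda_1^2-4\varepsilon=0,\qquad \lambda_2=\dots=\lambda_n=\tfrac12\lambda_1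 .$$ Then $M^n$ (if $M^n$ is not connected: the connected component of $p$) is locally centroaffinely equivalent to the hypersurface $$x_{n+1}=\frac{1}{2x_1}\sum_{k=2}^n x_k^2+x_1\ln x_1,\qquad x_1>0;$$ that is, for every point $q$ of it there are an invertible linear map $A$ of $\mathbb{R}^{n+1}$, an open neighbourhood $U$ of $q$ and a diffeomorphism $\varphi=(\varphi_1,\dots,\varphi_n)$ of $U$ onto an open subset of the half-space $\{t\in\mathbb{R}^n: t_1>0\}$ such that on $U$ $$A\circ x=\Big(\varphi_1,\dots,\varphi_n,\ \frac{1}{2\varphi_1}\sum_{k=2}^n\varphi_k^2+\varphi_1\ln\varphi_1\Big).$$ -/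

import Mathlib

open scoped Manifold ContDiff Matrix

noncomputable section

namespace Centroaffine

/-! ### Centroaffine invariants in a coordinate system

Let `y` be a centroaffine immersion of an open set of the coordinate space `ℝⁿ` into `ℝⁿ⁺¹`. All
geometric objects are evaluated on vector fields with constant coefficients `v w z a : ℝⁿ` with
respect to the coordinates, at a point `u`. -/

/-- Coordinate space `ℝⁿ`, on which the manifolds are modelled. -/
abbrev Coord (n : ℕ) : Type := EuclideanSpace ℝ (Fin n)

/-- The ambient affine space `ℝⁿ⁺¹` (with origin `0`). -/
abbrev Ambient (n : ℕ) : Type := Fin (n + 1) → ℝ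

variable {n : ℕ}

/-- The linear map `(v, t) ↦ y_*(v) + t (-ε y)` from `ℝⁿ × ℝ` to `ℝⁿ⁺¹` at the point `u`. It is
invertible when `y` is an immersion at `u` and its position vector is transversal. -/
def frame (ε : ℝ) (y : Coord n → Ambient n) (u : Coord n) : (Coord n × ℝ) →L[ℝ] Ambient n :=
  (fderiv ℝ y u).coprod (ContinuousLinearMap.toSpanSingleton ℝ (-ε • y u))

/-- The two components of `D_v y_*(w)` in the Gauss formula
`D_v y_*(w) = y_*(∇_v w) + h(v, w) (-ε y)`. -/
def gauss (ε : ℝ) (y : Coord n → Ambient n) (u v w : Coord n) : Coord n × ℝ :=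
  (frame ε y u).inverse (fderiv ℝ (fderiv ℝ y) u v w)

/-- The induced connection `∇_v w`. -/
def conn (ε : ℝ) (y : Coord n → Ambient n) (u v w : Coord n) : Coord n :=
  (gauss ε y u v w).1

/-- The centroaffine metric `h(v, w)` induced by the centroaffine normal `-ε y`. -/
def metric (ε : ℝ) (y : Coord n → Ambient n) (u v w : Coord n) : ℝ :=
  (gauss ε y u v w).2

/-- The matrix `(h_ij)` of the centroaffine metric. -/
def metricMatrix (ε : ℝ) (y : Coord n → Ambient n) (u : Coord n) : Matrix (Fin n) (Fin n) ℝ :=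
  Matrix.of fun i j => metric ε y u (EuclideanSpace.single i 1) (EuclideanSpace.single j 1)

/-- The Levi-Civita connection `∇̂_v w` of the centroaffine metric, by the Christoffel formula: its
`k`-th coordinate is `½ ∑ₗ hᵏˡ (∂_v h(w, ∂ₗ) + ∂_w h(v, ∂ₗ) - ∂ₗ h(v, w))`. -/
def leviCivita (ε : ℝ) (y : Coord n → Ambient n) (u v w : Coord n) : Coord n :=
  WithLp.toLp 2 ((metricMatrix ε y u)⁻¹ *ᵥ fun l =>
    (1 / 2 : ℝ) * (fderiv ℝ (fun u' => metric ε y u' w (EuclideanSpace.single l 1)) u v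
      + fderiv ℝ (fun u' => metric ε y u' v (EuclideanSpace.single l 1)) u w
      - fderiv ℝ (fun u' => metric ε y u' v w) u (EuclideanSpace.single l 1)))

/-- The difference tensor `K_v w = ∇_v w - ∇̂_v w`. -/
def diffTensor (ε : ℝ) (y : Coord n → Ambient n) (u v w : Coord n) : Coord n :=
  conn ε y u v w - leviCivita ε y u v w

/-- The cubic form `C = ∇h`, that is,
`C(v, w, z) = v (h(w, z)) - h(∇_v w, z) - h(w, ∇_v z)`. -/
def cubicForm (ε : ℝ) (y : Coord n → Ambient n) (u v w z : Coord n) : ℝ :=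
  fderiv ℝ (fun u' => metric ε y u' w z) u v
    - metric ε y u (conn ε y u v w) z - metric ε y u w (conn ε y u v z)

/-- The covariant derivative `(∇̂_a C)(v, w, z)` of the cubic form with respect to the Levi-Civita
connection of the centroaffine metric. -/
def covDerivCubicForm (ε : ℝ) (y : Coord n → Ambient n) (u a v w z : Coord n) : ℝ :=
  fderiv ℝ (fun u' => cubicForm ε y u' v w z) u a
    - cubicForm ε y u (leviCivita ε y u a v) w z
    - cubicForm ε y u v (leviCivita ε y u a w) z
    - cubicForm ε y u v w (leviCivita ε y u a z)

/-- A typical basis at the point `u`: an `h`-orthonormal basis `e` of the tangent space whose first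
vector is an absolute maximum point of `f(v) = h(K_v v, v)` on the `h`-unit sphere, and which
diagonalizes `K_{e₁}` with eigenvalues `lam` (the first index is `0`). Automatically
`lam 0 = f(e₁) = max f`. -/
structure IsTypicalBasis [NeZero n] (ε : ℝ) (y : Coord n → Ambient n) (u : Coord n)
    (e : Fin n → Coord n) (lam : Fin n → ℝ) : Prop where
  orthonormal : ∀ i j, metric ε y u (e i) (e j) = if i = j then 1 else 0
  isMax : ∀ v, metric ε y u v v = 1 →
    metric ε y u (diffTensor ε y u v v) v
      ≤ metric ε y u (diffTensor ε y u (e 0) (e 0)) (e 0)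
  eigen : ∀ i, diffTensor ε y u (e 0) (e i) = lam i • e i

/-! ### Hypersurfaces -/

variable {M : Type*} [TopologicalSpace M] [ChartedSpace (Coord n) M]

/-- `x : M → ℝⁿ⁺¹` is a locally strongly convex centroaffine hypersurface and the sign `ε` is chosen
such that its centroaffine metric is positive definite. The metric is looked at in every smooth
coordinate system `φ` of `M`, in which `x` reads `x ∘ φ⁻¹`. -/
structure IsLocallyStronglyConvex (ε : ℝ) (x : M → Ambient n) : Prop where
  sign : ε = 1 ∨ ε = -1
  smooth : ContMDiff (𝓡 n) 𝓘(ℝ, Ambient n) ∞ x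
  immersion : ∀ p, Function.Injective (mfderiv (𝓡 n) 𝓘(ℝ, Ambient n) x p)
  transversal : ∀ p, ∀ v : TangentSpace (𝓡 n) p, mfderiv (𝓡 n) 𝓘(ℝ, Ambient n) x p v ≠ x p
  posDef : ∀ φ ∈ IsManifold.maximalAtlas (𝓡 n) ∞ M, ∀ u ∈ φ.target,
    (metricMatrix ε (x ∘ φ.symm) u).PosDef

/-- `∇̂C = 0` on all of `M`. -/
def HasParallelCubicForm (ε : ℝ) (x : M → Ambient n) : Prop :=
  ∀ φ ∈ IsManifold.maximalAtlas (𝓡 n) ∞ M, ∀ u ∈ φ.target, ∀ a v w z : Coord n,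
    covDerivCubicForm ε (x ∘ φ.symm) u a v w z = 0

/-- Case `𝔅` occurs at `p`: there is a typical basis of `T_pM` (in some smooth coordinate system
around `p`; the objects involved are tensors, so the choice does not matter) with
`λ₁² - 4ε = 0` and `λ₂ = ⋯ = λₙ = λ₁ / 2`. -/
def CaseB [NeZero n] (ε : ℝ) (x : M → Ambient n) (p : M) : Prop :=
  ∃ φ ∈ IsManifold.maximalAtlas (𝓡 n) ∞ M, p ∈ φ.source ∧
    ∃ (e : Fin n → Coord n) (lam : Fin n → ℝ),
      IsTypicalBasis ε (x ∘ φ.symm) (φ p) e lam ∧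
      lam 0 ^ 2 - 4 * ε = 0 ∧ ∀ i, i ≠ 0 → lam i = lam 0 / 2

/-- Near `q`, the immersion `x` agrees with the parametrized hypersurface `ψ : Ω → ℝⁿ⁺¹`, `Ω ⊆ ℝⁿ`,
up to a centroaffine transformation `A` (an invertible linear map of `ℝⁿ⁺¹`) and a diffeomorphism
`φ` of an open neighbourhood of `q` onto an open subset of `Ω`. -/
def CentroaffinelyEquivalentNear (x : M → Ambient n) (q : M) (ψ : Coord n → Ambient n)
    (Ω : Set (Coord n)) : Prop :=
  ∃ A : Ambient n ≃ₗ[ℝ] Ambient n, ∃ φ ∈ IsManifold.maximalAtlas (𝓡 n) ∞ M,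
    q ∈ φ.source ∧ φ.target ⊆ Ω ∧ ∀ p ∈ φ.source, A (x p) = ψ (φ p)

/-- The hypersurface `x_{n+1} = (1 / (2 x₁)) ∑_{k=2}^n x_k² + x₁ ln x₁`, as a graph over
`(x₁, …, xₙ)`; it is a hypersurface over the half-space `x₁ > 0`. -/
def canonicalGraph [NeZero n] (t : Coord n) : Ambient n :=
  Fin.snoc (α := fun _ => ℝ) (fun i => t i)
    (1 / (2 * t 0) * ∑ k ∈ Finset.univ.erase (0 : Fin n), t k ^ 2 + t 0 * Real.log (t 0))

/-- The domain `x₁ > 0` of the graph. -/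
def canonicalDomain (n : ℕ) [NeZero n] : Set (Coord n) := {t | 0 < t 0}

end Centroaffine

end

/-!
In Case `𝔅` the maximum `λ₁ ≥ 0` of the odd function `f` satisfies `λ₁² = 4ε`, so `ε = 1` and
`λ₁ = 2`. Expanding `f` to third order at its maximum point `e₁` shows that `h(K_v v, v) = 0` for
`v ⊥ e₁`; hence, with `E = e₁` and `η = h(E, ·)`, the difference tensor is the tensor expression
`K_a b = h(a, b) E + η(a) b + η(b) a - η(a) η(b) E` (`eq_model_of_isMax`).

This form propagates. The trace of the formula gives `η(a) = tr K_a / (n + 1)`, so `η` and `E` are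
restrictions of tensor fields defined everywhere. As `C`, and with it `K`, is parallel, so are
these fields and the defect of the formula, and a parallel tensor field vanishing at one point of
a convex coordinate domain vanishes on it (`IsRegularOn.isAxis_of_convex`). Since metric and cubic
form are tensors, the set of points where the formula holds is open and closed
(`isClopen_hasAxisAt`).

Where the formula holds, the coordinates of the canonical graph are linear functionals of the
position vector, so no flat coordinates have to be constructed. For a functional `β`, the function
`g = β ∘ x` solves the system `Hess g = -g h` of the induced connection, and solutions are
determined by their value and differential at one point (`IsModelOn.eq_zero_of_hessian`).
Functionals are chosen by their values on the frame at one point. One of them, `t = l ∘ x`,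
satisfies `dt = t η` (`IsModelOn.comp_fderiv_eq_smul`). The others, `βₖ` with `k = 2, …, n`, vanish
on the fixed direction of `x_* E - x`; then with `yₖ = βₖ ∘ x` the forms `d(yₖ / t)` are parallel,
and together with `η` they form an orthonormal coframe (`IsModelOn.metricL_eq_sum`). It follows that
`t (½ ∑ₖ (yₖ / t)² + log t)` solves the same system, so it is a linear functional of `x` too
(`IsModelOn.graph_equation`), which is the equation of the canonical graph.
-/

noncomputable section

-- norms of trilinear maps are found through nested instance problems
set_option maxSynthPendingDepth 3

namespace Centroaffine

/-! ### Linear differential inequalities and norms of derivations -/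

section Analysis

variable {E F : Type*} [NormedAddCommGroup E] [NormedSpace ℝ E]
  [NormedAddCommGroup F] [NormedSpace ℝ F]

/-- Uniqueness for linear total differential systems: a function with `‖df‖ ≤ κ ‖f‖` that vanishes
at one point of a convex set vanishes on it, by Grönwall's inequality along segments. -/
theorem eq_zero_of_norm_fderiv_le {U : Set E} (hU : Convex ℝ U) {f : E → F} {κ : E → ℝ}
    (hκ : ContinuousOn κ U) (hf : ∀ u ∈ U, DifferentiableAt ℝ f u)
    (hb : ∀ u ∈ U, ∀ a, ‖fderiv ℝ f u a‖ ≤ κ u * ‖a‖ * ‖f u‖)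
    {u₀ : E} (hu₀ : u₀ ∈ U) (h₀ : f u₀ = 0) : ∀ u ∈ U, f u = 0 := by
  intro u hu
  set c : ℝ → E := fun s => u₀ + s • (u - u₀) with hc
  have hcU : ∀ s ∈ Set.Icc (0 : ℝ) 1, c s ∈ U := fun s hs =>
    hU.add_smul_sub_mem hu₀ hu hs
  have hcd : ∀ s, HasDerivAt c (u - u₀) s := fun s => by
    simpa [hc] using ((hasDerivAt_id s).smul_const (u - u₀)).const_add u₀
  have hcc : Continuous c := by fun_prop
  have hκc : ContinuousOn (fun s => κ (c s)) (Set.Icc 0 1) :=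
    hκ.comp hcc.continuousOn hcU
  obtain ⟨B, hB⟩ := (isCompact_Icc.image_of_continuousOn hκc).bddAbove
  have hd : ∀ s ∈ Set.Icc (0 : ℝ) 1,
      HasDerivAt (fun s => f (c s)) (fderiv ℝ f (c s) (u - u₀)) s := fun s hs =>
    (hf _ (hcU s hs)).hasFDerivAt.comp_hasDerivAt s (hcd s)
  have := norm_le_gronwallBound_of_norm_deriv_right_le (f := fun s => f (c s))
    (f' := fun s => fderiv ℝ f (c s) (u - u₀)) (δ := 0) (K := B * ‖u - u₀‖) (ε := 0)
    (a := 0) (b := 1)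
    (fun s hs => (hd s hs).continuousAt.continuousWithinAt)
    (fun s hs => (hd s (Set.Ico_subset_Icc_self hs)).hasDerivWithinAt)
    (by simp [hc, h₀])
    (fun s hs => by
      have hs' := Set.Ico_subset_Icc_self hs
      refine (hb _ (hcU s hs') _).trans ?_
      rw [add_zero]
      gcongr
      exact hB ⟨s, hs', rfl⟩) 1 (by simp)
  simpa [gronwallBound_ε0_δ0, hc] using this

theorem opNorm_le_of_derivation₂ {T S : E →L[ℝ] E →L[ℝ] ℝ} {A : E →L[ℝ] E}
    (h : ∀ a b, S a b = T (A a) b + T a (A b)) : ‖S‖ ≤ 2 * ‖A‖ * ‖T‖ := by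
  refine S.opNorm_le_bound₂ (by positivity) fun a b => ?_
  have h1 := T.le_opNorm₂ (A a) b
  have h2 := T.le_opNorm₂ a (A b)
  have ha := A.le_opNorm a
  have hb := A.le_opNorm b
  rw [h]
  calc ‖T (A a) b + T a (A b)‖ ≤ ‖T‖ * ‖A a‖ * ‖b‖ + ‖T‖ * ‖a‖ * ‖A b‖ :=
        (norm_add_le _ _).trans (add_le_add h1 h2)
    _ ≤ ‖T‖ * (‖A‖ * ‖a‖) * ‖b‖ + ‖T‖ * ‖a‖ * (‖A‖ * ‖b‖) := by gcongr
    _ = _ := by ring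

theorem opNorm_le_of_derivation₃ {T S : E →L[ℝ] E →L[ℝ] E →L[ℝ] ℝ} {A : E →L[ℝ] E}
    (h : ∀ a b c, S a b c = T (A a) b c + T a (A b) c + T a b (A c)) :
    ‖S‖ ≤ 3 * ‖A‖ * ‖T‖ := by
  refine S.opNorm_le_bound (by positivity) fun a => ?_
  refine (S a).opNorm_le_bound₂ (by positivity) fun b c => ?_
  have key : ∀ a b c, ‖T a b c‖ ≤ ‖T‖ * ‖a‖ * ‖b‖ * ‖c‖ := fun a b c =>
    ((T a).le_opNorm₂ b c).trans (by gcongr; exact T.le_opNorm a)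
  have ha := A.le_opNorm a
  have hb := A.le_opNorm b
  have hc := A.le_opNorm c
  rw [h]
  calc ‖T (A a) b c + T a (A b) c + T a b (A c)‖
      ≤ ‖T‖ * ‖A a‖ * ‖b‖ * ‖c‖ + ‖T‖ * ‖a‖ * ‖A b‖ * ‖c‖ + ‖T‖ * ‖a‖ * ‖b‖ * ‖A c‖ :=
        (norm_add₃_le).trans (add_le_add (add_le_add (key _ _ _) (key _ _ _)) (key _ _ _))
    _ ≤ ‖T‖ * (‖A‖ * ‖a‖) * ‖b‖ * ‖c‖ + ‖T‖ * ‖a‖ * (‖A‖ * ‖b‖) * ‖c‖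
        + ‖T‖ * ‖a‖ * ‖b‖ * (‖A‖ * ‖c‖) := by gcongr
    _ = _ := by ring

end Analysis

/-! ### The Gauss formula -/

section Gauss

variable {n : ℕ} {ε : ℝ} {y : Coord n → Ambient n} {U : Set (Coord n)} {u : Coord n}

/-- The Gauss decomposition `gauss` of the second derivative, as a bilinear map. -/
def gaussL (ε : ℝ) (y : Coord n → Ambient n) (u : Coord n) :
    Coord n →L[ℝ] Coord n →L[ℝ] Coord n × ℝ :=
  (ContinuousLinearMap.compL ℝ (Coord n) (Ambient n) (Coord n × ℝ) (frame ε y u).inverse).comp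
    (fderiv ℝ (fderiv ℝ y) u)

/-- The induced connection `conn`, as a bilinear map. -/
def connL (ε : ℝ) (y : Coord n → Ambient n) (u : Coord n) :
    Coord n →L[ℝ] Coord n →L[ℝ] Coord n :=
  (ContinuousLinearMap.compL ℝ (Coord n) (Coord n × ℝ) (Coord n)
    (ContinuousLinearMap.fst ℝ (Coord n) ℝ)).comp (gaussL ε y u)

/-- The centroaffine metric `metric`, as a bilinear map. -/
def metricL (ε : ℝ) (y : Coord n → Ambient n) (u : Coord n) :
    Coord n →L[ℝ] Coord n →L[ℝ] ℝ :=
  (ContinuousLinearMap.compL ℝ (Coord n) (Coord n × ℝ) ℝ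
    (ContinuousLinearMap.snd ℝ (Coord n) ℝ)).comp (gaussL ε y u)

theorem connL_apply (v w : Coord n) : connL ε y u v w = conn ε y u v w := rfl

theorem metricL_apply (v w : Coord n) : metricL ε y u v w = metric ε y u v w := rfl

/-- `y` is smooth on the open set `U` and its centroaffine metric is positive definite there. The
immersion and transversality conditions need not be listed: where they fail, `frame` has no inverse,
its formal inverse is `0`, and so is the metric. -/
structure IsRegularOn (ε : ℝ) (y : Coord n → Ambient n) (U : Set (Coord n)) : Prop where
  isOpen : IsOpen U
  smooth : ContDiffOn ℝ ∞ y U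
  posDef : ∀ u ∈ U, (metricMatrix ε y u).PosDef

theorem frame_apply (v : Coord n) (t : ℝ) :
    frame ε y u (v, t) = fderiv ℝ y u v + t • (-ε • y u) := by
  simp [frame]

namespace IsRegularOn

theorem mono (h : IsRegularOn ε y U) {V : Set (Coord n)} (hV : IsOpen V) (hVU : V ⊆ U) :
    IsRegularOn ε y V :=
  ⟨hV, h.smooth.mono hVU, fun u hu => h.posDef u (hVU hu)⟩

/-- Where `frame` is not invertible its `inverse` is `0` by convention, so the metric vanishes,
contradicting positive definiteness. -/
theorem frame_isInvertible [NeZero n] (h : IsRegularOn ε y U) (hu : u ∈ U) :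
    (frame ε y u).IsInvertible := by
  by_contra hn
  have h1 := (h.posDef u hu).diag_pos (i := 0)
  have h2 : (frame ε y u).inverse = 0 := ContinuousLinearMap.inverse_of_not_isInvertible hn
  simp [metricMatrix, metric, gauss, h2] at h1

theorem contDiffOn_fderiv (h : IsRegularOn ε y U) : ContDiffOn ℝ ∞ (fderiv ℝ y) U :=
  h.smooth.fderiv_of_isOpen h.isOpen (by simp)

theorem contDiffOn_fderiv_fderiv (h : IsRegularOn ε y U) :
    ContDiffOn ℝ ∞ (fderiv ℝ (fderiv ℝ y)) U :=
  h.contDiffOn_fderiv.fderiv_of_isOpen h.isOpen (by simp)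

theorem contDiffOn_frame (h : IsRegularOn ε y U) : ContDiffOn ℝ ∞ (frame ε y) U := by
  rw [contDiffOn_clm_apply]
  rintro ⟨v, t⟩
  simp only [frame_apply]
  exact (h.contDiffOn_fderiv.clm_apply contDiffOn_const).add
    ((h.smooth.const_smul (-ε)).const_smul t)

theorem contDiffOn_gaussL [NeZero n] (h : IsRegularOn ε y U) :
    ContDiffOn ℝ ∞ (gaussL ε y) U := by
  have hinv : ContDiffOn ℝ ∞ (fun u => (frame ε y u).inverse) U := fun u hu =>
    ((h.frame_isInvertible hu).contDiffAt_map_inverse).comp_contDiffWithinAt u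
      (h.contDiffOn_frame u hu)
  simp only [contDiffOn_clm_apply]
  intro v w
  exact hinv.clm_apply ((h.contDiffOn_fderiv_fderiv.clm_apply contDiffOn_const).clm_apply
    contDiffOn_const)

theorem contDiffOn_connL [NeZero n] (h : IsRegularOn ε y U) : ContDiffOn ℝ ∞ (connL ε y) U :=
  contDiffOn_const.clm_comp h.contDiffOn_gaussL

theorem contDiffOn_metricL [NeZero n] (h : IsRegularOn ε y U) : ContDiffOn ℝ ∞ (metricL ε y) U :=
  contDiffOn_const.clm_comp h.contDiffOn_gaussL

theorem contDiffAt (h : IsRegularOn ε y U) (hu : u ∈ U) : ContDiffAt ℝ ∞ y u :=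
  h.smooth.contDiffAt (h.isOpen.mem_nhds hu)

theorem hasFDerivAt (h : IsRegularOn ε y U) (hu : u ∈ U) : HasFDerivAt y (fderiv ℝ y u) u :=
  ((h.contDiffAt hu).differentiableAt (by simp)).hasFDerivAt

theorem hasFDerivAt_of_contDiffOn {F : Type*} [NormedAddCommGroup F] [NormedSpace ℝ F]
    {f : Coord n → F} (h : IsRegularOn ε y U) (hf : ContDiffOn ℝ ∞ f U) (hu : u ∈ U) :
    HasFDerivAt f (fderiv ℝ f u) u :=
  ((hf.contDiffAt (h.isOpen.mem_nhds hu)).differentiableAt (by simp)).hasFDerivAt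

theorem gauss_formula [NeZero n] (h : IsRegularOn ε y U) (hu : u ∈ U) (v w : Coord n) :
    fderiv ℝ (fderiv ℝ y) u v w
      = fderiv ℝ y u (connL ε y u v w) + metricL ε y u v w • (-ε • y u) := by
  rw [← frame_apply]
  exact ((h.frame_isInvertible hu).self_apply_inverse _).symm

theorem frame_injective [NeZero n] (h : IsRegularOn ε y U) (hu : u ∈ U) {v w : Coord n} {s t : ℝ}
    (hvw : fderiv ℝ y u v + s • (-ε • y u) = fderiv ℝ y u w + t • (-ε • y u)) : v = w ∧ s = t := by
  rw [← frame_apply, ← frame_apply] at hvw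
  have := (h.frame_isInvertible hu).injective hvw
  simpa using this

theorem second_symm (h : IsRegularOn ε y U) (hu : u ∈ U) (v w : Coord n) :
    fderiv ℝ (fderiv ℝ y) u v w = fderiv ℝ (fderiv ℝ y) u w v :=
  (h.contDiffAt hu).isSymmSndFDerivAt (by simp; exact WithTop.coe_le_coe.2 le_top) v w

theorem gaussL_symm (h : IsRegularOn ε y U) (hu : u ∈ U) (v w : Coord n) :
    gaussL ε y u v w = gaussL ε y u w v := by
  simp [gaussL, h.second_symm hu v w]

theorem metricL_symm (h : IsRegularOn ε y U) (hu : u ∈ U) (v w : Coord n) :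
    metricL ε y u v w = metricL ε y u w v := congrArg Prod.snd (h.gaussL_symm hu v w)

theorem connL_symm (h : IsRegularOn ε y U) (hu : u ∈ U) (v w : Coord n) :
    connL ε y u v w = connL ε y u w v := congrArg Prod.fst (h.gaussL_symm hu v w)

theorem metricL_eq_dotProduct (v w : Coord n) :
    metricL ε y u v w = v.ofLp ⬝ᵥ (metricMatrix ε y u *ᵥ w.ofLp) := by
  have hv : v = ∑ i, v i • EuclideanSpace.single i (1 : ℝ) := by
    ext j; simp [Pi.single_apply]
  have hw : w = ∑ i, w i • EuclideanSpace.single i (1 : ℝ) := by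
    ext j; simp [Pi.single_apply]
  conv_lhs => rw [hv, hw]
  simp only [map_sum, map_smul, FunLike.coe_sum, FunLike.coe_smul, Finset.sum_apply, Pi.smul_apply, metricL_apply,
    dotProduct, Matrix.mulVec, metricMatrix, Matrix.of_apply, smul_eq_mul, Finset.mul_sum]
  rw [Finset.sum_comm]
  exact Finset.sum_congr rfl fun i _ => Finset.sum_congr rfl fun j _ => by ring

theorem metricL_pos (h : IsRegularOn ε y U) (hu : u ∈ U) {v : Coord n} (hv : v ≠ 0) :
    0 < metricL ε y u v v := by
  have := (h.posDef u hu).dotProduct_mulVec_pos (x := v.ofLp) (by simpa using hv)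
  rw [metricL_eq_dotProduct]
  simpa using this

theorem eq_of_metricL_eq (h : IsRegularOn ε y U) (hu : u ∈ U) {v w : Coord n}
    (hvw : ∀ z, metricL ε y u v z = metricL ε y u w z) : v = w := by
  by_contra hne
  have := h.metricL_pos hu (sub_ne_zero.2 hne)
  simp [hvw] at this

theorem metricL_isInvertible (h : IsRegularOn ε y U) (hu : u ∈ U) :
    (metricL ε y u).IsInvertible := by
  have hinj : Function.Injective (metricL ε y u).toLinearMap := fun v w hvw =>
    h.eq_of_metricL_eq hu fun z => by
      have := congrArg (fun T : Coord n →L[ℝ] ℝ => T z) hvw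
      simpa using this
  have hdim : Module.finrank ℝ (Coord n) = Module.finrank ℝ (Coord n →L[ℝ] ℝ) := by
    rw [← (LinearMap.toContinuousLinearMap (𝕜 := ℝ) (E := Coord n) (F' := ℝ)).finrank_eq]
    exact (Subspace.dual_finrank_eq).symm
  refine ⟨(LinearEquiv.ofInjectiveOfFinrankEq (metricL ε y u).toLinearMap hinj hdim).toContinuousLinearEquiv, ?_⟩
  ext v w
  rfl

end IsRegularOn

end Gauss

/-! ### The cubic form, the difference tensor and the Levi-Civita connection -/

section DifferenceTensor

variable {n : ℕ} {ε : ℝ} {y : Coord n → Ambient n} {U : Set (Coord n)} {u : Coord n}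

/-- The trilinear form `(a, b, c) ↦ h(∇_a b, c)`. -/
def metricConnL (ε : ℝ) (y : Coord n → Ambient n) (u : Coord n) :
    Coord n →L[ℝ] Coord n →L[ℝ] Coord n →L[ℝ] ℝ :=
  (ContinuousLinearMap.compL ℝ (Coord n) (Coord n) (Coord n →L[ℝ] ℝ) (metricL ε y u)).comp
    (connL ε y u)

/-- The cubic form, as a trilinear map. The term `h(b, ∇_a c)` of `cubicForm` is written
`h(∇_a c, b)`, which agrees with it where `h` is symmetric. -/
def cubicL (ε : ℝ) (y : Coord n → Ambient n) (u : Coord n) :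
    Coord n →L[ℝ] Coord n →L[ℝ] Coord n →L[ℝ] ℝ :=
  fderiv ℝ (metricL ε y) u - metricConnL ε y u
    - ((ContinuousLinearMap.flipₗᵢ ℝ (Coord n) (Coord n) ℝ).toContinuousLinearEquiv :
        (Coord n →L[ℝ] Coord n →L[ℝ] ℝ) →L[ℝ] _).comp (metricConnL ε y u)

theorem cubicL_apply (a b c : Coord n) :
    cubicL ε y u a b c = fderiv ℝ (metricL ε y) u a b c - metricL ε y u (connL ε y u a b) c
      - metricL ε y u (connL ε y u a c) b := rfl

/-- The difference tensor, defined from the cubic form by `h(K_a b, c) = -½ C(a, b, c)`. It agrees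
with `diffTensor`, see `IsRegularOn.diffTensor_eq`. -/
def diffL (ε : ℝ) (y : Coord n → Ambient n) (u : Coord n) :
    Coord n →L[ℝ] Coord n →L[ℝ] Coord n :=
  (-1 / 2 : ℝ) • (ContinuousLinearMap.compL ℝ (Coord n) (Coord n →L[ℝ] ℝ) (Coord n)
    (metricL ε y u).inverse).comp (cubicL ε y u)

theorem diffL_apply (a b : Coord n) :
    diffL ε y u a b = (-1 / 2 : ℝ) • (metricL ε y u).inverse (cubicL ε y u a b) := rfl

/-- The connection `∇ - K`. It is torsion-free and metric, hence agrees with `leviCivita`, see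
`IsRegularOn.leviCivita_eq`. -/
def leviL (ε : ℝ) (y : Coord n → Ambient n) (u : Coord n) :
    Coord n →L[ℝ] Coord n →L[ℝ] Coord n :=
  connL ε y u - diffL ε y u

theorem leviL_apply (a b : Coord n) :
    leviL ε y u a b = connL ε y u a b - diffL ε y u a b := rfl

namespace IsRegularOn
variable [NeZero n]

theorem fderiv_metric (h : IsRegularOn ε y U) (hu : u ∈ U) (v w z : Coord n) :
    fderiv ℝ (fun u' => metric ε y u' w z) u v = fderiv ℝ (metricL ε y) u v w z := by
  have h1 := h.hasFDerivAt_of_contDiffOn h.contDiffOn_metricL hu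
  have h2 := (h1.clm_apply (hasFDerivAt_const w u)).clm_apply (hasFDerivAt_const z u)
  change fderiv ℝ (fun u' => metricL ε y u' w z) u v = _
  rw [h2.fderiv]
  simp

theorem cubicForm_eq (h : IsRegularOn ε y U) (hu : u ∈ U) (v w z : Coord n) :
    cubicForm ε y u v w z = cubicL ε y u v w z := by
  rw [cubicL_apply, h.metricL_symm hu _ w, ← h.fderiv_metric hu]
  rfl

theorem contDiffOn_fderiv_metricL (h : IsRegularOn ε y U) :
    ContDiffOn ℝ ∞ (fderiv ℝ (metricL ε y)) U :=
  h.contDiffOn_metricL.fderiv_of_isOpen h.isOpen (by simp)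

theorem contDiffOn_cubicL (h : IsRegularOn ε y U) : ContDiffOn ℝ ∞ (cubicL ε y) U := by
  simp only [contDiffOn_clm_apply, cubicL_apply]
  intro a b c
  have hH := h.contDiffOn_metricL
  have hG := h.contDiffOn_connL
  have hc : ∀ a : Coord n, ContDiffOn ℝ ∞ (fun _ : Coord n => a) U := fun _ => contDiffOn_const
  exact ((((h.contDiffOn_fderiv_metricL.clm_apply (hc a)).clm_apply (hc b)).clm_apply (hc c)).sub
    ((hH.clm_apply ((hG.clm_apply (hc a)).clm_apply (hc b))).clm_apply (hc c))).sub
    ((hH.clm_apply ((hG.clm_apply (hc a)).clm_apply (hc c))).clm_apply (hc b))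

theorem contDiffOn_metricL_inverse (h : IsRegularOn ε y U) :
    ContDiffOn ℝ ∞ (fun u => (metricL ε y u).inverse) U := fun u hu =>
  ((h.metricL_isInvertible hu).contDiffAt_map_inverse).comp_contDiffWithinAt u
    (h.contDiffOn_metricL u hu)

theorem contDiffOn_diffL (h : IsRegularOn ε y U) : ContDiffOn ℝ ∞ (diffL ε y) U := by
  simp only [contDiffOn_clm_apply, diffL_apply]
  intro a b
  exact ContDiffOn.const_smul _ (h.contDiffOn_metricL_inverse.clm_apply
    ((h.contDiffOn_cubicL.clm_apply contDiffOn_const).clm_apply contDiffOn_const))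

theorem contDiffOn_leviL (h : IsRegularOn ε y U) : ContDiffOn ℝ ∞ (leviL ε y) U :=
  h.contDiffOn_connL.sub h.contDiffOn_diffL

theorem fderiv_metricL_symm (h : IsRegularOn ε y U) (hu : u ∈ U) (a b c : Coord n) :
    fderiv ℝ (metricL ε y) u a b c = fderiv ℝ (metricL ε y) u a c b := by
  rw [← h.fderiv_metric hu, ← h.fderiv_metric hu]
  congr 1
  refine Filter.EventuallyEq.fderiv_eq ?_
  filter_upwards [h.isOpen.mem_nhds hu] with u' hu' using h.metricL_symm hu' b c

/-- The Codazzi equation for the metric: the transversal component of the symmetry of the third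
derivative of `y`. -/
theorem codazzi (h : IsRegularOn ε y U) (hu : u ∈ U) (v w z : Coord n) :
    fderiv ℝ (metricL ε y) u v w z + metricL ε y u v (connL ε y u w z)
      = fderiv ℝ (metricL ε y) u w v z + metricL ε y u w (connL ε y u v z) := by
  have hU := h.isOpen.mem_nhds hu
  have key : ∀ v w, fderiv ℝ (fderiv ℝ (fderiv ℝ y)) u v w z
      = fderiv ℝ y u (connL ε y u v (connL ε y u w z) + fderiv ℝ (connL ε y) u v w z
          - (ε * metricL ε y u w z) • v)
        + (fderiv ℝ (metricL ε y) u v w z + metricL ε y u v (connL ε y u w z)) • (-ε • y u) := by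
    intro v w
    have hy := h.hasFDerivAt hu
    have h1 := h.hasFDerivAt_of_contDiffOn h.contDiffOn_fderiv hu
    have h2 := h.hasFDerivAt_of_contDiffOn h.contDiffOn_fderiv_fderiv hu
    have hH := h.hasFDerivAt_of_contDiffOn h.contDiffOn_metricL hu
    have hG := h.hasFDerivAt_of_contDiffOn h.contDiffOn_connL hu
    have cst := fun a : Coord n => hasFDerivAt_const (𝕜 := ℝ) a u
    have e1 := (h2.clm_apply (cst w)).clm_apply (cst z)
    have e2 := (h1.clm_apply ((hG.clm_apply (cst w)).clm_apply (cst z))).add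
      (((hH.clm_apply (cst w)).clm_apply (cst z)).smul (hy.const_smul (-ε)))
    have e3 := e1.unique (e2.congr_of_eventuallyEq (by
      filter_upwards [hU] with u' hu' using h.gauss_formula hu' w z))
    have e4 := congrArg (fun T : Coord n →L[ℝ] Ambient n => T v) e3
    simp only [add_apply, ContinuousLinearMap.comp_apply, ContinuousLinearMap.flip_apply,
      zero_apply, map_zero, zero_add, smul_apply, ContinuousLinearMap.smulRight_apply,
      Pi.smul_apply] at e4
    rw [h.gauss_formula hu v] at e4
    rw [e4]
    simp only [map_add, map_sub, map_smul]
    module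
  have hs := (h.contDiffOn_fderiv.contDiffAt hU).isSymmSndFDerivAt
    (by simp; exact WithTop.coe_le_coe.2 le_top) v w
  have hs' := congrArg (fun T : Coord n →L[ℝ] Ambient n => T z) hs
  rw [key, key] at hs'
  exact (h.frame_injective hu hs').2

theorem cubicL_symm₂₃ (h : IsRegularOn ε y U) (hu : u ∈ U) (a b c : Coord n) :
    cubicL ε y u a b c = cubicL ε y u a c b := by
  rw [cubicL_apply, cubicL_apply, h.fderiv_metricL_symm hu]
  ring

theorem cubicL_symm₁₂ (h : IsRegularOn ε y U) (hu : u ∈ U) (a b c : Coord n) :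
    cubicL ε y u a b c = cubicL ε y u b a c := by
  have := h.codazzi hu a b c
  rw [cubicL_apply, cubicL_apply, h.connL_symm hu b a, h.metricL_symm hu _ b,
    h.metricL_symm hu _ a]
  linarith

omit [NeZero n] in
theorem metricL_diffL (h : IsRegularOn ε y U) (hu : u ∈ U) (a b c : Coord n) :
    metricL ε y u (diffL ε y u a b) c = -1 / 2 * cubicL ε y u a b c := by
  rw [diffL_apply, map_smul, (h.metricL_isInvertible hu).self_apply_inverse]
  rfl

theorem diffL_symm (h : IsRegularOn ε y U) (hu : u ∈ U) (a b : Coord n) :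
    diffL ε y u a b = diffL ε y u b a :=
  h.eq_of_metricL_eq hu fun z => by
    rw [h.metricL_diffL hu, h.metricL_diffL hu, h.cubicL_symm₁₂ hu]

theorem leviL_symm (h : IsRegularOn ε y U) (hu : u ∈ U) (a b : Coord n) :
    leviL ε y u a b = leviL ε y u b a := by
  rw [leviL_apply, leviL_apply, h.connL_symm hu, h.diffL_symm hu]

/-- The connection `leviL` is metric. -/
theorem fderiv_metricL (h : IsRegularOn ε y U) (hu : u ∈ U) (a b c : Coord n) :
    fderiv ℝ (metricL ε y) u a b c
      = metricL ε y u (leviL ε y u a b) c + metricL ε y u b (leviL ε y u a c) := by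
  have h1 := cubicL_apply (ε := ε) (y := y) (u := u) a b c
  have h2 := h.metricL_diffL hu a b c
  have h3 := h.metricL_diffL hu a c b
  have h4 := h.cubicL_symm₂₃ hu a b c
  rw [h.metricL_symm hu b, leviL_apply, leviL_apply]
  simp only [map_sub, sub_apply]
  linarith

/-- The Koszul formula identifies the torsion-free metric connection `leviL`. -/
theorem leviCivita_eq (h : IsRegularOn ε y U) (hu : u ∈ U) (v w : Coord n) :
    leviCivita ε y u v w = leviL ε y u v w := by
  have hdet : IsUnit (metricMatrix ε y u).det := (h.posDef u hu).det_pos.ne'.isUnit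
  have key : (fun l => (1 / 2 : ℝ) *
      (fderiv ℝ (fun u' => metric ε y u' w (EuclideanSpace.single l 1)) u v
      + fderiv ℝ (fun u' => metric ε y u' v (EuclideanSpace.single l 1)) u w
      - fderiv ℝ (fun u' => metric ε y u' v w) u (EuclideanSpace.single l 1)))
      = metricMatrix ε y u *ᵥ (leviL ε y u v w).ofLp := by
    ext l
    have h1 : (metricMatrix ε y u *ᵥ (leviL ε y u v w).ofLp) l
        = metricL ε y u (EuclideanSpace.single l 1) (leviL ε y u v w) := by
      rw [metricL_eq_dotProduct]
      simp
    rw [h1, h.fderiv_metric hu, h.fderiv_metric hu, h.fderiv_metric hu, h.fderiv_metricL hu,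
      h.fderiv_metricL hu, h.fderiv_metricL hu]
    generalize (EuclideanSpace.single l 1 : Coord n) = z
    rw [h.leviL_symm hu w v, h.leviL_symm hu z v, h.leviL_symm hu z w,
      h.metricL_symm hu z, h.metricL_symm hu v (leviL ε y u w z),
      h.metricL_symm hu w (leviL ε y u v z)]
    ring
  rw [leviCivita, key, Matrix.mulVec_mulVec, Matrix.nonsing_inv_mul _ hdet, Matrix.one_mulVec]

theorem diffTensor_eq (h : IsRegularOn ε y U) (hu : u ∈ U) (v w : Coord n) :
    diffTensor ε y u v w = diffL ε y u v w := by
  rw [diffTensor, h.leviCivita_eq hu, leviL_apply, ← connL_apply]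
  abel

/-- The hypothesis `∇̂C = 0` in terms of the trilinear map `cubicL`. -/
theorem fderiv_cubicL (h : IsRegularOn ε y U)
    (hC : ∀ u ∈ U, ∀ a v w z, covDerivCubicForm ε y u a v w z = 0) (hu : u ∈ U)
    (a b c d : Coord n) :
    fderiv ℝ (cubicL ε y) u a b c d = cubicL ε y u (leviL ε y u a b) c d
      + cubicL ε y u b (leviL ε y u a c) d + cubicL ε y u b c (leviL ε y u a d) := by
  have h1 := hC u hu a b c d
  have h2 : fderiv ℝ (fun u' => cubicForm ε y u' b c d) u a
      = fderiv ℝ (cubicL ε y) u a b c d := by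
    have e : (fun u' => cubicForm ε y u' b c d) =ᶠ[nhds u] fun u' => cubicL ε y u' b c d := by
      filter_upwards [h.isOpen.mem_nhds hu] with u' hu' using h.cubicForm_eq hu' b c d
    have h3 := h.hasFDerivAt_of_contDiffOn h.contDiffOn_cubicL hu
    have h4 := ((h3.clm_apply (hasFDerivAt_const b u)).clm_apply (hasFDerivAt_const c u)).clm_apply
      (hasFDerivAt_const d u)
    rw [e.fderiv_eq, h4.fderiv]
    simp
  rw [covDerivCubicForm, h2] at h1
  simp only [h.cubicForm_eq hu, h.leviCivita_eq hu] at h1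
  linarith

end IsRegularOn

end DifferenceTensor

/-! ### Symmetric cubic forms with a maximum on the unit sphere -/

section Algebra

/-- Polarization. -/
theorem eq_zero_of_cubic_eq_zero {E : Type*} [AddCommGroup E] {D : E → E → E → ℝ}
    (hadd : ∀ a a' b c, D (a + a') b c = D a b c + D a' b c)
    (h₁₂ : ∀ a b c, D a b c = D b a c) (h₂₃ : ∀ a b c, D a b c = D a c b)
    (h : ∀ a, D a a a = 0) (a b c : E) : D a b c = 0 := by
  have add₂ : ∀ a b b' c, D a (b + b') c = D a b c + D a b' c := fun a b b' c => by
    rw [h₁₂, hadd, h₁₂ b, h₁₂ b']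
  have add₃ : ∀ a b c c', D a b (c + c') = D a b c + D a b c' := fun a b c c' => by
    rw [h₂₃, add₂, h₂₃ a c, h₂₃ a c']
  have h2 : ∀ a b, D a a b + D a b b = 0 := fun a b => by
    have := h (a + b)
    simp only [hadd, add₂, add₃, h] at this
    have e1 := h₁₂ b a a
    have e2 := h₂₃ a b a
    have e3 := h₂₃ b b a
    have e4 := h₁₂ b a b
    linarith
  have h3 := h2 a (b + c)
  simp only [add₂, add₃] at h3
  have := h2 a b
  have := h2 a c
  have := h₂₃ a b c
  linarith

variable {E : Type*} [NormedAddCommGroup E] [NormedSpace ℝ E]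

/-- If `k(v, v, v)` is maximal at `e` on the unit sphere and `k(e, ·, ·) = h + h(e, ·) ⊗ h(e, ·)`, then
along the great circle `cos θ e + sin θ a` the terms of order `θ²` cancel, and the term `θ³ k(a, a, a)`
must be non-positive. -/
theorem cubic_nonpos_of_isMax {H : E →L[ℝ] E →L[ℝ] ℝ} {k : E →L[ℝ] E →L[ℝ] E →L[ℝ] ℝ}
    (hH : ∀ a b, H a b = H b a) (hpos : ∀ a, a ≠ 0 → 0 < H a a)
    (h₁₂ : ∀ a b c, k a b c = k b a c) (h₂₃ : ∀ a b c, k a b c = k a c b)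
    {e : E} (he : H e e = 1) (hmax : ∀ v, H v v = 1 → k v v v ≤ 2)
    (hk : ∀ b c, k e b c = H b c + H e b * H e c) {a : E} (ha : H e a = 0) :
    k a a a ≤ 0 := by
  have unit : ∀ b, H e b = 0 → H b b = 1 → k b b b ≤ 0 := by
    intro b heb hbb
    by_contra! hf
    set f := k b b b with hfdef
    set s := min (1 / 2) (f / 6) with hs
    have hs0 : 0 < s := by positivity
    have hs1 : s ≤ 1 / 2 := min_le_left _ _
    have hs2 : s ≤ f / 6 := min_le_right _ _
    have hsq : s ^ 2 ≤ 1 / 4 := by nlinarith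
    set c := √(1 - s ^ 2) with hc
    have hc0 : 0 ≤ c := Real.sqrt_nonneg _
    have hc2 : c ^ 2 = 1 - s ^ 2 := Real.sq_sqrt (by linarith)
    have hc1 : c ≤ 1 := by nlinarith
    have hbe : H b e = 0 := by rw [hH, heb]
    have hv : H (c • e + s • b) (c • e + s • b) = 1 := by
      simp only [map_add, map_smul, add_apply, smul_apply, smul_eq_mul, he, heb, hbe, hbb]
      linear_combination hc2
    have h1 := hmax _ hv
    have k1 : k b e e = 0 := by rw [h₁₂, hk]; simp [hbe, heb]
    have k2 : k b e b = 1 := by rw [h₁₂, hk]; simp [heb, hbb]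
    have k3 : k b b e = 1 := by rw [h₂₃, k2]
    simp only [map_add, map_smul, add_apply, smul_apply, smul_eq_mul, hk, he, heb, hbe, hbb,
      k1, k2, k3, ← hfdef] at h1
    -- the maximality inequality reads `s³ f ≤ (1 - c)² (2 + c)`, which is of order `s⁴`
    have h2 : s ^ 3 * f ≤ (1 - c) ^ 2 * (2 + c) := by
      have : c * s ^ 2 = c * (1 - c ^ 2) := by rw [hc2]; ring
      nlinarith
    have h3 : 1 - c ≤ s ^ 2 := by nlinarith
    have h4 : (1 - c) ^ 2 ≤ (s ^ 2) ^ 2 := by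
      have : 0 ≤ 1 - c := by linarith
      gcongr
    have h5 : s ^ 3 * f ≤ s ^ 3 * (3 * s) := by
      calc s ^ 3 * f ≤ (1 - c) ^ 2 * (2 + c) := h2
        _ ≤ (s ^ 2) ^ 2 * 3 := by
          apply mul_le_mul h4 (by linarith) (by linarith) (by positivity)
        _ = _ := by ring
    have h6 := le_of_mul_le_mul_left h5 (by positivity)
    linarith
  by_cases h0 : a = 0
  · simp [h0]
  have hp := hpos a h0
  set r := √(H a a) with hr
  have hr0 : 0 < r := Real.sqrt_pos.2 hp
  have hr2 : r ^ 2 = H a a := Real.sq_sqrt hp.le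
  have := unit (r⁻¹ • a) (by simp [ha]) (by
    simp only [map_smul, smul_apply, smul_eq_mul, ← hr2]
    field_simp)
  simp only [map_smul, smul_apply, smul_eq_mul] at this
  have h7 : k a a a = r ^ 3 * (r⁻¹ * (r⁻¹ * (r⁻¹ * k a a a))) := by field_simp
  rw [h7]
  exact mul_nonpos_of_nonneg_of_nonpos (by positivity) this

/-- Under the hypotheses of `cubic_nonpos_of_isMax` the cubic form is determined by `h` and `e`. -/
theorem eq_model_of_isMax {H : E →L[ℝ] E →L[ℝ] ℝ} {k : E →L[ℝ] E →L[ℝ] E →L[ℝ] ℝ}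
    (hH : ∀ a b, H a b = H b a) (hpos : ∀ a, a ≠ 0 → 0 < H a a)
    (h₁₂ : ∀ a b c, k a b c = k b a c) (h₂₃ : ∀ a b c, k a b c = k a c b)
    {e : E} (he : H e e = 1) (hmax : ∀ v, H v v = 1 → k v v v ≤ 2)
    (hk : ∀ b c, k e b c = H b c + H e b * H e c) (a b c : E) :
    k a b c = H a b * H e c + H a c * H e b + H b c * H e a - H e a * H e b * H e c := by
  suffices hD : ∀ a, k a a a = 3 * H a a * H e a - H e a ^ 3 by
    rw [← sub_eq_zero]
    refine eq_zero_of_cubic_eq_zero (D := fun a b c => k a b c -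
      (H a b * H e c + H a c * H e b + H b c * H e a - H e a * H e b * H e c)) ?_ ?_ ?_ ?_ a b c
    · intro a a' b c
      simp only [map_add, add_apply]
      ring
    · intro a b c
      simp only [h₁₂ a b c, hH a b]
      ring
    · intro a b c
      simp only [h₂₃ a b c, hH b c]
      ring
    · intro a
      simp only [hD]
      ring
  intro a
  set t := H e a with ht
  set w := a - t • e with hw
  have hew : H e w = 0 := by simp [hw, he, ← ht]
  have h1 := cubic_nonpos_of_isMax hH hpos h₁₂ h₂₃ he hmax hk hew
  have h2 := cubic_nonpos_of_isMax hH hpos h₁₂ h₂₃ he hmax hk (a := -w) (by simp [hew])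
  simp only [map_neg, neg_apply] at h2
  have h3 : k w w w = 0 := by linarith
  have haw : a = t • e + w := by simp [hw]
  have hwe : H w e = 0 := by rw [hH, hew]
  have k1 : k w e e = 0 := by rw [h₁₂, hk]; simp [hwe, hew]
  have k2 : k w e w = H w w := by rw [h₁₂, hk]; simp [hew]
  have k3 : k w w e = H w w := by rw [h₂₃, k2]
  rw [haw]
  simp only [map_add, map_smul, add_apply, smul_apply, smul_eq_mul, hk, he, hwe, hew, k1, k2, k3,
    h3]
  ring

end Algebra

/-! ### Case `𝔅` as a tensor equation -/

section Axis

variable {n : ℕ} {ε : ℝ} {y : Coord n → Ambient n} {U : Set (Coord n)} {u : Coord n}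

/-- The unit vector `e` spans the axis of the cubic form at `u`: with `η = h(e, ·)`,
`h(K_a b, c) = h(a, b) η(c) + h(a, c) η(b) + h(b, c) η(a) - η(a) η(b) η(c)`. This is the invariant
form of Case `𝔅`, in which `K_e e = 2 e`, `K_e b = b` and `K_b b' = h(b, b') e` for `b, b' ⊥ e`. -/
def IsAxis (ε : ℝ) (y : Coord n → Ambient n) (u e : Coord n) : Prop :=
  metricL ε y u e e = 1 ∧ ∀ a b c, -1 / 2 * cubicL ε y u a b c
    = metricL ε y u a b * metricL ε y u e c + metricL ε y u a c * metricL ε y u e b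
      + metricL ε y u b c * metricL ε y u e a
      - metricL ε y u e a * metricL ε y u e b * metricL ε y u e c

namespace IsRegularOn
variable [NeZero n]

theorem isAxis_of_isTypicalBasis (h : IsRegularOn ε y U) (hu : u ∈ U) {e : Fin n → Coord n}
    {lam : Fin n → ℝ} (he : IsTypicalBasis ε y u e lam) (hlam₀ : lam 0 = 2)
    (hlam : ∀ i, i ≠ 0 → lam i = 1) : IsAxis ε y u (e 0) := by
  have orth := he.orthonormal
  simp only [← metricL_apply] at orth
  have heig := he.eigen
  simp only [h.diffTensor_eq hu] at heig
  have he0 : metricL ε y u (e 0) (e 0) = 1 := by simp [orth]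
  have hmax := he.isMax
  simp only [← metricL_apply, h.diffTensor_eq hu, heig 0, map_smul, hlam₀] at hmax
  have hli : LinearIndependent ℝ e := by
    rw [Fintype.linearIndependent_iff]
    intro g hg i
    have := congrArg (metricL ε y u (e i)) hg
    simpa [orth] using this
  have hspan := hli.span_eq_top_of_card_eq_finrank (by simp)
  refine ⟨he0, ?_⟩
  have := eq_model_of_isMax (H := metricL ε y u) (k := (-1 / 2 : ℝ) • cubicL ε y u)
    (h.metricL_symm hu) (fun a => h.metricL_pos hu)
    (fun a b c => by simp [h.cubicL_symm₁₂ hu a b c])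
    (fun a b c => by simp [h.cubicL_symm₂₃ hu a b c]) he0
    (fun v hv => by
      have := hmax v hv
      rw [h.metricL_diffL hu] at this
      simpa [he0] using this)
    (fun b c => by
      have : ((((-1 / 2 : ℝ) • cubicL ε y u) (e 0)).flip c).toLinearMap
          = ((metricL ε y u).flip c + metricL ε y u (e 0) c • metricL ε y u (e 0)).toLinearMap := by
        refine LinearMap.ext_on_range hspan fun i => ?_
        have h1 := h.metricL_diffL hu (e 0) (e i) c
        rw [heig] at h1
        simp only [map_smul, smul_apply, smul_eq_mul] at h1
        simp only [ContinuousLinearMap.coe_coe, ContinuousLinearMap.flip_apply, smul_apply,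
          smul_eq_mul, add_apply, ← h1, orth]
        by_cases hi : i = 0
        · subst hi
          simp only [hlam₀, if_true]
          ring
        · simp [hlam i hi, Ne.symm hi]
      have := LinearMap.congr_fun this b
      simp only [ContinuousLinearMap.coe_coe, ContinuousLinearMap.flip_apply, smul_apply,
          smul_eq_mul, add_apply] at this ⊢
      rw [this]
      ring)
  intro a b c
  rw [← this a b c]
  rfl

/-! The metric and the cubic form are tensors. -/

section Transform

variable {y' : Coord n → Ambient n} {U' : Set (Coord n)} {θ : Coord n → Coord n}

/-- Behaviour of the Gauss formula under a change of coordinates `θ`: the metric is a tensor, and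
the connection picks up the second derivative of `θ`. -/
theorem gauss_comp (h : IsRegularOn ε y U) (h' : IsRegularOn ε y' U') (hθ : ContDiffOn ℝ ∞ θ U)
    (hm : Set.MapsTo θ U U') (hy : Set.EqOn y (y' ∘ θ) U) (hu : u ∈ U) :
    fderiv ℝ y u = (fderiv ℝ y' (θ u)).comp (fderiv ℝ θ u) ∧
    ∀ v w, fderiv ℝ θ u (connL ε y u v w)
        = connL ε y' (θ u) (fderiv ℝ θ u v) (fderiv ℝ θ u w) + fderiv ℝ (fderiv ℝ θ) u v w ∧
      metricL ε y u v w = metricL ε y' (θ u) (fderiv ℝ θ u v) (fderiv ℝ θ u w) := by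
  have hU := h.isOpen.mem_nhds hu
  have hθ1 := h.hasFDerivAt_of_contDiffOn hθ hu
  have hθ2 := h.hasFDerivAt_of_contDiffOn (hθ.fderiv_of_isOpen h.isOpen (by simp)) hu
  have hd : ∀ u ∈ U, fderiv ℝ y u = (fderiv ℝ y' (θ u)).comp (fderiv ℝ θ u) := fun u hu =>
    (((h'.hasFDerivAt (hm hu)).comp u (h.hasFDerivAt_of_contDiffOn hθ hu)).congr_of_eventuallyEq
      (hy.eventuallyEq_of_mem (h.isOpen.mem_nhds hu))).fderiv
  refine ⟨hd u hu, fun v w => ?_⟩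
  have e1 := (h.hasFDerivAt_of_contDiffOn h.contDiffOn_fderiv hu).clm_apply
    (hasFDerivAt_const w u)
  have e2 := ((h'.hasFDerivAt_of_contDiffOn h'.contDiffOn_fderiv (hm hu)).comp u hθ1).clm_apply
    (hθ2.clm_apply (hasFDerivAt_const w u))
  have e3 := e1.unique (e2.congr_of_eventuallyEq (by
    filter_upwards [hU] with u' hu'
    rw [hd u' hu']
    rfl))
  have e4 := congrArg (fun T : Coord n →L[ℝ] Ambient n => T v) e3
  simp only [add_apply, ContinuousLinearMap.comp_apply, ContinuousLinearMap.flip_apply,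
      zero_apply, map_zero, zero_add, Function.comp_apply] at e4
  rw [h.gauss_formula hu, h'.gauss_formula (hm hu), hd u hu] at e4
  have e5 : y u = y' (θ u) := hy hu
  rw [e5, ContinuousLinearMap.comp_apply] at e4
  exact h'.frame_injective (hm hu) (v := fderiv ℝ θ u (connL ε y u v w)) (by
    rw [e4, map_add]; module)

theorem cubicL_comp (h : IsRegularOn ε y U) (h' : IsRegularOn ε y' U') (hθ : ContDiffOn ℝ ∞ θ U)
    (hm : Set.MapsTo θ U U') (hy : Set.EqOn y (y' ∘ θ) U) (hu : u ∈ U) (a b c : Coord n) :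
    cubicL ε y u a b c
      = cubicL ε y' (θ u) (fderiv ℝ θ u a) (fderiv ℝ θ u b) (fderiv ℝ θ u c) := by
  have hU := h.isOpen.mem_nhds hu
  have hθ1 := h.hasFDerivAt_of_contDiffOn hθ hu
  have hθ2 := h.hasFDerivAt_of_contDiffOn (hθ.fderiv_of_isOpen h.isOpen (by simp)) hu
  have e1 := ((h.hasFDerivAt_of_contDiffOn h.contDiffOn_metricL hu).clm_apply
    (hasFDerivAt_const b u)).clm_apply (hasFDerivAt_const c u)
  have e2 := (((h'.hasFDerivAt_of_contDiffOn h'.contDiffOn_metricL (hm hu)).comp u hθ1).clm_apply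
    (hθ2.clm_apply (hasFDerivAt_const b u))).clm_apply (hθ2.clm_apply (hasFDerivAt_const c u))
  have e3 := e1.unique (e2.congr_of_eventuallyEq (by
    filter_upwards [hU] with u' hu' using ((h.gauss_comp h' hθ hm hy hu').2 b c).2))
  have e4 := congrArg (fun T : Coord n →L[ℝ] ℝ => T a) e3
  simp only [add_apply, ContinuousLinearMap.comp_apply, ContinuousLinearMap.flip_apply,
      zero_apply, map_zero, zero_add, Function.comp_apply] at e4
  have g := fun v w => (h.gauss_comp h' hθ hm hy hu).2 v w
  rw [cubicL_apply, cubicL_apply, e4, (g _ _).2, (g _ _).2, (g _ _).1, (g _ _).1,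
    h'.metricL_symm (hm hu) (fderiv ℝ θ u b)]
  simp only [map_add, add_apply]
  ring

/-- The existence of an axis is independent of the coordinates. -/
theorem exists_isAxis_comp (h : IsRegularOn ε y U) (h' : IsRegularOn ε y' U')
    (hθ : ContDiffOn ℝ ∞ θ U) (hm : Set.MapsTo θ U U') (hy : Set.EqOn y (y' ∘ θ) U) (hu : u ∈ U)
    (hax : ∃ e, IsAxis ε y' (θ u) e) : ∃ e, IsAxis ε y u e := by
  obtain ⟨e', he1, he2⟩ := hax
  have hinj : Function.Injective (fderiv ℝ θ u).toLinearMap := fun v w hvw => by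
    refine (h.frame_injective hu (v := v) (w := w) (s := 0) (t := 0) ?_).1
    rw [(h.gauss_comp h' hθ hm hy hu).1]
    simp only [ContinuousLinearMap.comp_apply]
    rw [show fderiv ℝ θ u v = fderiv ℝ θ u w from hvw]
  obtain ⟨e, rfl⟩ := (LinearMap.injective_iff_surjective.1 hinj) e'
  have g := fun v w => ((h.gauss_comp h' hθ hm hy hu).2 v w).2
  refine ⟨e, by rw [g]; exact he1, fun a b c => ?_⟩
  rw [h.cubicL_comp h' hθ hm hy hu]
  simp only [g]
  exact he2 _ _ _

end Transform
end IsRegularOn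

end Axis

/-! ### Propagation of the axis -/

section Propagation

variable {n : ℕ} {ε : ℝ} {y : Coord n → Ambient n} {U : Set (Coord n)} {u : Coord n}

/-- The trace of an endomorphism, as a continuous linear map. -/
def traceL (n : ℕ) : (Coord n →L[ℝ] Coord n) →L[ℝ] ℝ :=
  LinearMap.toContinuousLinearMap
    ((LinearMap.trace ℝ (Coord n)).comp (ContinuousLinearMap.coeLM ℝ))

theorem traceL_apply (A : Coord n →L[ℝ] Coord n) :
    traceL n A = LinearMap.trace ℝ (Coord n) A.toLinearMap := rfl

/-- The Tchebychev form `a ↦ tr K_a / (n + 1)`. The factor is chosen such that it equals `h(e, ·)`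
wherever `e` is an axis. -/
def tchebychev (ε : ℝ) (y : Coord n → Ambient n) (u : Coord n) : Coord n →L[ℝ] ℝ :=
  (1 / (n + 1 : ℝ)) • (traceL n).comp (diffL ε y u)

theorem tchebychev_apply (a : Coord n) :
    tchebychev ε y u a = 1 / (n + 1 : ℝ) * traceL n (diffL ε y u a) := rfl

/-- The vector field dual to the Tchebychev form. -/
def axis (ε : ℝ) (y : Coord n → Ambient n) (u : Coord n) : Coord n :=
  (metricL ε y u).inverse (tchebychev ε y u)

/-- The amount by which `K` fails to have the form of `IsAxis`, with the Tchebychev form as `η`. -/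
def defect (ε : ℝ) (y : Coord n → Ambient n) (u : Coord n) :
    Coord n →L[ℝ] Coord n →L[ℝ] Coord n →L[ℝ] ℝ :=
  (-1 / 2 : ℝ) • cubicL ε y u
    - ((ContinuousLinearMap.smulRightL ℝ (Coord n) (Coord n →L[ℝ] ℝ)).flip
        (tchebychev ε y u)).comp (metricL ε y u)
    - (ContinuousLinearMap.smulRightL ℝ (Coord n) (Coord n →L[ℝ] ℝ)
        (tchebychev ε y u)).comp (metricL ε y u)
    - (tchebychev ε y u).smulRight (metricL ε y u)
    + (tchebychev ε y u).smulRight ((tchebychev ε y u).smulRight (tchebychev ε y u))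

theorem defect_apply (a b c : Coord n) :
    defect ε y u a b c = -1 / 2 * cubicL ε y u a b c
      - metricL ε y u a b * tchebychev ε y u c - tchebychev ε y u b * metricL ε y u a c
      - tchebychev ε y u a * metricL ε y u b c
      + tchebychev ε y u a * (tchebychev ε y u b * tchebychev ε y u c) := rfl

namespace IsRegularOn
variable [NeZero n]

omit [NeZero n] in
theorem metricL_axis (h : IsRegularOn ε y U) (hu : u ∈ U) (a : Coord n) :
    metricL ε y u (axis ε y u) a = tchebychev ε y u a := by
  rw [axis, (h.metricL_isInvertible hu).self_apply_inverse]

omit [NeZero n] in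
theorem diffL_eq_of_isAxis (h : IsRegularOn ε y U) (hu : u ∈ U) {e : Coord n}
    (he : IsAxis ε y u e) (a b : Coord n) :
    diffL ε y u a b = metricL ε y u a b • e + metricL ε y u e a • b + metricL ε y u e b • a
      - (metricL ε y u e a * metricL ε y u e b) • e :=
  h.eq_of_metricL_eq hu fun z => by
    rw [h.metricL_diffL hu, he.2]
    simp only [map_add, map_sub, map_smul, add_apply, sub_apply, smul_apply, smul_eq_mul]
    ring

omit [NeZero n] in
theorem tchebychev_eq_of_isAxis (h : IsRegularOn ε y U) (hu : u ∈ U) {e : Coord n}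
    (he : IsAxis ε y u e) (a : Coord n) : tchebychev ε y u a = metricL ε y u e a := by
  have h1 : (diffL ε y u a).toLinearMap
      = (metricL ε y u a).toLinearMap.smulRight e + metricL ε y u e a • LinearMap.id
        + (metricL ε y u e).toLinearMap.smulRight a
        - metricL ε y u e a • (metricL ε y u e).toLinearMap.smulRight e := by
    ext1 b
    simpa [mul_smul] using h.diffL_eq_of_isAxis hu he a b
  rw [tchebychev_apply, traceL_apply, h1]
  simp only [map_add, map_sub, map_smul, LinearMap.trace_smulRight, LinearMap.trace_id,
    ContinuousLinearMap.coe_coe, h.metricL_symm hu a e, he.1, finrank_euclideanSpace,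
    Fintype.card_fin, smul_eq_mul]
  field_simp
  ring

omit [NeZero n] in
theorem axis_eq_of_isAxis (h : IsRegularOn ε y U) (hu : u ∈ U) {e : Coord n}
    (he : IsAxis ε y u e) : axis ε y u = e :=
  h.eq_of_metricL_eq hu fun z => by rw [h.metricL_axis hu, h.tchebychev_eq_of_isAxis hu he]

omit [NeZero n] in
theorem isAxis_axis_iff (h : IsRegularOn ε y U) (hu : u ∈ U) :
    IsAxis ε y u (axis ε y u) ↔
      tchebychev ε y u (axis ε y u) = 1 ∧ defect ε y u = 0 := by
  simp only [IsAxis, h.metricL_axis hu]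
  refine and_congr_right fun _ => ⟨fun hd => ?_, fun hd a b c => ?_⟩
  · ext a b c
    rw [defect_apply, hd]
    simp only [zero_apply]
    ring
  · have := congrArg (fun T : Coord n →L[ℝ] Coord n →L[ℝ] Coord n →L[ℝ] ℝ => T a b c) hd
    simp only [defect_apply, zero_apply] at this
    linarith

theorem contDiffOn_tchebychev (h : IsRegularOn ε y U) : ContDiffOn ℝ ∞ (tchebychev ε y) U :=
  ContDiffOn.const_smul _ (contDiffOn_const.clm_comp h.contDiffOn_diffL)

theorem contDiffOn_axis (h : IsRegularOn ε y U) : ContDiffOn ℝ ∞ (axis ε y) U :=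
  h.contDiffOn_metricL_inverse.clm_apply h.contDiffOn_tchebychev

theorem contDiffOn_defect (h : IsRegularOn ε y U) : ContDiffOn ℝ ∞ (defect ε y) U := by
  simp only [contDiffOn_clm_apply, defect_apply]
  intro a b c
  have hc : ∀ a : Coord n, ContDiffOn ℝ ∞ (fun _ : Coord n => a) U := fun _ => contDiffOn_const
  have hT := fun a => h.contDiffOn_tchebychev.clm_apply (hc a)
  have hH := fun a b => (h.contDiffOn_metricL.clm_apply (hc a)).clm_apply (hc b)
  have hC := ((h.contDiffOn_cubicL.clm_apply (hc a)).clm_apply (hc b)).clm_apply (hc c)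
  exact ((((contDiffOn_const.mul hC).sub ((hH a b).mul (hT c))).sub ((hT b).mul (hH a c))).sub
    ((hT a).mul (hH b c))).add ((hT a).mul ((hT b).mul (hT c)))

section Parallel

variable (h : IsRegularOn ε y U)
  (hC : ∀ u ∈ U, ∀ a v w z, covDerivCubicForm ε y u a v w z = 0)
include h hC

theorem fderiv_diffL (hu : u ∈ U) (a b c : Coord n) :
    fderiv ℝ (diffL ε y) u a b c = diffL ε y u (leviL ε y u a b) c
      + diffL ε y u b (leviL ε y u a c) - leviL ε y u a (diffL ε y u b c) := by
  refine h.eq_of_metricL_eq hu fun z => ?_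
  have cst := fun a : Coord n => hasFDerivAt_const (𝕜 := ℝ) a u
  have hK := h.hasFDerivAt_of_contDiffOn h.contDiffOn_diffL hu
  have hH := h.hasFDerivAt_of_contDiffOn h.contDiffOn_metricL hu
  have hCd := h.hasFDerivAt_of_contDiffOn h.contDiffOn_cubicL hu
  have e1 := (hH.clm_apply ((hK.clm_apply (cst b)).clm_apply (cst c))).clm_apply (cst z)
  have e2 := (((hCd.clm_apply (cst b)).clm_apply (cst c)).clm_apply (cst z)).const_smul
    (-1 / 2 : ℝ)
  have e3 := e1.unique (e2.congr_of_eventuallyEq (by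
    filter_upwards [h.isOpen.mem_nhds hu] with u' hu' using h.metricL_diffL hu' b c z))
  have e4 := congrArg (fun T : Coord n →L[ℝ] ℝ => T a) e3
  simp only [add_apply, ContinuousLinearMap.comp_apply, ContinuousLinearMap.flip_apply,
      zero_apply, map_zero, zero_add, smul_apply, smul_eq_mul] at e4
  rw [h.fderiv_metricL hu, h.fderiv_cubicL hC hu, h.metricL_diffL hu b c] at e4
  simp only [map_add, map_sub, add_apply, sub_apply, h.metricL_diffL hu]
  linarith

theorem fderiv_tchebychev (hu : u ∈ U) (a b : Coord n) :
    fderiv ℝ (tchebychev ε y) u a b = tchebychev ε y u (leviL ε y u a b) := by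
  have hK := h.hasFDerivAt_of_contDiffOn h.contDiffOn_diffL hu
  have e1 := (((traceL n).hasFDerivAt.comp u (hK.clm_apply (hasFDerivAt_const b u))).const_smul
    (1 / (n + 1 : ℝ)))
  have e2 := (h.hasFDerivAt_of_contDiffOn h.contDiffOn_tchebychev hu).clm_apply
    (hasFDerivAt_const b u)
  have e3 := congrArg (fun T : Coord n →L[ℝ] ℝ => T a) (e2.unique e1)
  simp only [add_apply, ContinuousLinearMap.comp_apply, ContinuousLinearMap.flip_apply,
      zero_apply, map_zero, zero_add, smul_apply, smul_eq_mul] at e3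
  have e4 : fderiv ℝ (diffL ε y) u a b = diffL ε y u (leviL ε y u a b)
      + (diffL ε y u b).comp (leviL ε y u a) - (leviL ε y u a).comp (diffL ε y u b) := by
    ext1 c
    exact h.fderiv_diffL hC hu a b c
  have e5 : traceL n ((diffL ε y u b).comp (leviL ε y u a))
      = traceL n ((leviL ε y u a).comp (diffL ε y u b)) :=
    LinearMap.trace_mul_comm ℝ (diffL ε y u b).toLinearMap (leviL ε y u a).toLinearMap
  rw [e3, e4, map_sub, map_add, e5, tchebychev_apply]
  ring

theorem fderiv_axis (hu : u ∈ U) (a : Coord n) :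
    fderiv ℝ (axis ε y) u a = -leviL ε y u a (axis ε y u) := by
  refine h.eq_of_metricL_eq hu fun z => ?_
  have hE := h.hasFDerivAt_of_contDiffOn h.contDiffOn_axis hu
  have hH := h.hasFDerivAt_of_contDiffOn h.contDiffOn_metricL hu
  have hT := h.hasFDerivAt_of_contDiffOn h.contDiffOn_tchebychev hu
  have e1 := (hH.clm_apply hE).clm_apply (hasFDerivAt_const z u)
  have e2 := e1.unique ((hT.clm_apply (hasFDerivAt_const z u)).congr_of_eventuallyEq (by
    filter_upwards [h.isOpen.mem_nhds hu] with u' hu' using h.metricL_axis hu' z))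
  have e3 := congrArg (fun T : Coord n →L[ℝ] ℝ => T a) e2
  simp only [add_apply, ContinuousLinearMap.comp_apply, ContinuousLinearMap.flip_apply,
      zero_apply, map_zero, zero_add] at e3
  rw [h.fderiv_metricL hu, h.fderiv_tchebychev hC hu, h.metricL_axis hu] at e3
  simp only [map_neg, neg_apply]
  linarith

theorem fderiv_defect (hu : u ∈ U) (v a b c : Coord n) :
    fderiv ℝ (defect ε y) u v a b c = defect ε y u (leviL ε y u v a) b c
      + defect ε y u a (leviL ε y u v b) c + defect ε y u a b (leviL ε y u v c) := by
  have cst := fun a : Coord n => hasFDerivAt_const (𝕜 := ℝ) a u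
  have hD := h.hasFDerivAt_of_contDiffOn h.contDiffOn_defect hu
  have hH := fun a b => ((h.hasFDerivAt_of_contDiffOn h.contDiffOn_metricL hu).clm_apply
    (cst a)).clm_apply (cst b)
  have hT := fun a => (h.hasFDerivAt_of_contDiffOn h.contDiffOn_tchebychev hu).clm_apply (cst a)
  have hQ := (((h.hasFDerivAt_of_contDiffOn h.contDiffOn_cubicL hu).clm_apply (cst a)).clm_apply
    (cst b)).clm_apply (cst c)
  have e1 := ((((hQ.const_smul (-1 / 2 : ℝ)).sub ((hH a b).mul (hT c))).sub
    ((hT b).mul (hH a c))).sub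
    ((hT a).mul (hH b c))).add ((hT a).mul ((hT b).mul (hT c)))
  have e2 := ((hD.clm_apply (cst a)).clm_apply (cst b)).clm_apply (cst c)
  have e3 := congrArg (fun T : Coord n →L[ℝ] ℝ => T v) (e2.unique e1)
  simp only [add_apply, sub_apply, ContinuousLinearMap.comp_apply, ContinuousLinearMap.flip_apply,
      zero_apply, map_zero, zero_add, smul_apply, smul_eq_mul, Pi.mul_apply] at e3
  rw [e3, h.fderiv_cubicL hC hu]
  simp only [h.fderiv_metricL hu, h.fderiv_tchebychev hC hu, defect_apply]
  ring

/-- The existence of an axis propagates over convex coordinate domains: the defect and the length of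
the vector field `axis` are parallel. -/
theorem isAxis_of_convex (hconv : Convex ℝ U) {u₀ : Coord n} (hu₀ : u₀ ∈ U)
    (h₀ : ∃ e, IsAxis ε y u₀ e) (hu : u ∈ U) : IsAxis ε y u (axis ε y u) := by
  obtain ⟨e, he⟩ := h₀
  have h₀ : IsAxis ε y u₀ (axis ε y u₀) := by rwa [h.axis_eq_of_isAxis hu₀ he]
  rw [h.isAxis_axis_iff hu₀] at h₀
  rw [h.isAxis_axis_iff hu]
  have hE := fun u (hu : u ∈ U) => h.hasFDerivAt_of_contDiffOn h.contDiffOn_axis hu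
  have hT := fun u (hu : u ∈ U) => h.hasFDerivAt_of_contDiffOn h.contDiffOn_tchebychev hu
  have hN := fun u (hu : u ∈ U) => ((hT u hu).clm_apply (hE u hu)).sub_const 1
  refine ⟨sub_eq_zero.1 (eq_zero_of_norm_fderiv_le hconv (κ := 0) continuousOn_const
    (f := fun u => tchebychev ε y u (axis ε y u) - 1)
    (fun u hu => (hN u hu).differentiableAt) (fun u hu a => ?_) hu₀ (by simp [h₀.1]) u hu), ?_⟩
  · rw [(hN u hu).fderiv]
    simp [h.fderiv_tchebychev hC hu, h.fderiv_axis hC hu]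
  · refine eq_zero_of_norm_fderiv_le hconv (κ := fun u => 3 * ‖leviL ε y u‖)
      (h.contDiffOn_leviL.continuousOn.norm.const_smul (3 : ℝ))
      (fun u hu => (h.hasFDerivAt_of_contDiffOn h.contDiffOn_defect hu).differentiableAt)
      (fun u hu a => ?_) hu₀ h₀.2 u hu
    refine (opNorm_le_of_derivation₃ (h.fderiv_defect hC hu a)).trans ?_
    have := (leviL ε y u).le_opNorm a
    calc 3 * ‖leviL ε y u a‖ * ‖defect ε y u‖
        ≤ 3 * (‖leviL ε y u‖ * ‖a‖) * ‖defect ε y u‖ := by gcongr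
      _ = _ := by ring

end Parallel
end IsRegularOn

end Propagation

/-! ### Functionals of the position vector on a model domain -/

section Model

variable {n : ℕ} {y : Coord n → Ambient n} {U : Set (Coord n)} {u : Coord n}

/-- A hypersurface with `ε = 1` over a convex coordinate domain, with parallel cubic form and an
axis at every point. -/
structure IsModelOn (y : Coord n → Ambient n) (U : Set (Coord n)) : Prop where
  regular : IsRegularOn 1 y U
  convex : Convex ℝ U
  parallel : ∀ u ∈ U, ∀ a v w z, covDerivCubicForm 1 y u a v w z = 0
  isAxis : ∀ u ∈ U, IsAxis 1 y u (axis 1 y u)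

namespace IsModelOn
variable (h : IsModelOn y U)
include h

theorem mono {V : Set (Coord n)} (hV : IsOpen V) (hVc : Convex ℝ V) (hVU : V ⊆ U) :
    IsModelOn y V :=
  ⟨h.regular.mono hV hVU, hVc, fun u hu => h.parallel u (hVU hu), fun u hu => h.isAxis u (hVU hu)⟩

theorem tchebychev_axis (hu : u ∈ U) : tchebychev 1 y u (axis 1 y u) = 1 :=
  ((h.regular.isAxis_axis_iff hu).1 (h.isAxis u hu)).1

theorem connL_eq (hu : u ∈ U) (a b : Coord n) :
    connL 1 y u a b = leviL 1 y u a b + metricL 1 y u a b • axis 1 y u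
      + tchebychev 1 y u a • b + tchebychev 1 y u b • a
      - (tchebychev 1 y u a * tchebychev 1 y u b) • axis 1 y u := by
  have := h.regular.diffL_eq_of_isAxis hu (h.isAxis u hu) a b
  simp only [h.regular.metricL_axis hu] at this
  rw [leviL_apply, this]
  abel

theorem metricL_axis_right (hu : u ∈ U) (a : Coord n) :
    metricL 1 y u a (axis 1 y u) = tchebychev 1 y u a := by
  rw [h.regular.metricL_symm hu, h.regular.metricL_axis hu]

theorem hasFDerivAt_comp (β : Ambient n →L[ℝ] ℝ) (hu : u ∈ U) :
    HasFDerivAt (fun u => β (y u)) (β.comp (fderiv ℝ y u)) u :=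
  β.hasFDerivAt.comp u (h.regular.hasFDerivAt hu)

variable [NeZero n]

/-- Every functional `β` gives a solution `g = β ∘ y` of `∂_a dg(b) = dg(∇_a b) - h(a, b) g`. -/
theorem hasFDerivAt_comp_fderiv (β : Ambient n →L[ℝ] ℝ) (hu : u ∈ U) :
    ∃ T : Coord n →L[ℝ] Coord n →L[ℝ] ℝ,
      HasFDerivAt (fun u => β.comp (fderiv ℝ y u)) T u ∧
      ∀ a b, T a b = β (fderiv ℝ y u (connL 1 y u a b)) - metricL 1 y u a b * β (y u) := by
  refine ⟨_, ((ContinuousLinearMap.compL ℝ (Coord n) (Ambient n) ℝ β).hasFDerivAt).comp u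
    (h.regular.hasFDerivAt_of_contDiffOn h.regular.contDiffOn_fderiv hu), fun a b => ?_⟩
  change β (fderiv ℝ (fderiv ℝ y) u a b) = _
  rw [h.regular.gauss_formula hu]
  simp
  ring

/-- The equation `d(l ∘ y) = (l ∘ y) η` holds everywhere if it holds at one point: the difference
`f` of the two sides satisfies `∂_a f(b) = f(∇_a b) - f(a) η(b)`. -/
theorem comp_fderiv_eq_smul (l : Ambient n →L[ℝ] ℝ) {u₀ : Coord n} (hu₀ : u₀ ∈ U)
    (h₀ : l.comp (fderiv ℝ y u₀) = l (y u₀) • tchebychev 1 y u₀) (hu : u ∈ U) :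
    l.comp (fderiv ℝ y u) = l (y u) • tchebychev 1 y u := by
  rw [← sub_eq_zero]
  have hd : ∀ u ∈ U, ∃ T : Coord n →L[ℝ] Coord n →L[ℝ] ℝ,
      HasFDerivAt (fun u => l.comp (fderiv ℝ y u) - l (y u) • tchebychev 1 y u) T u ∧
      ∀ a b, T a b = (l.comp (fderiv ℝ y u) - l (y u) • tchebychev 1 y u) (connL 1 y u a b)
        - (l.comp (fderiv ℝ y u) - l (y u) • tchebychev 1 y u) a * tchebychev 1 y u b := by
    intro u hu
    obtain ⟨T, hT, hTe⟩ := h.hasFDerivAt_comp_fderiv l hu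
    refine ⟨_, hT.sub ((h.hasFDerivAt_comp l hu).smul
      (h.regular.hasFDerivAt_of_contDiffOn h.regular.contDiffOn_tchebychev hu)), fun a b => ?_⟩
    simp only [sub_apply, add_apply, smul_apply, ContinuousLinearMap.smulRight_apply,
      ContinuousLinearMap.comp_apply, smul_eq_mul, hTe,
      h.regular.fderiv_tchebychev h.parallel hu]
    have : tchebychev 1 y u (connL 1 y u a b) = tchebychev 1 y u (leviL 1 y u a b)
        + metricL 1 y u a b + tchebychev 1 y u a * tchebychev 1 y u b := by
      rw [h.connL_eq hu]
      simp only [map_add, map_sub, map_smul, smul_eq_mul, h.tchebychev_axis hu]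
      ring
    rw [this]
    ring
  refine eq_zero_of_norm_fderiv_le h.convex
    (κ := fun u => ‖connL 1 y u‖ + ‖tchebychev 1 y u‖)
    (f := fun u => l.comp (fderiv ℝ y u) - l (y u) • tchebychev 1 y u)
    (h.regular.contDiffOn_connL.continuousOn.norm.add
      h.regular.contDiffOn_tchebychev.continuousOn.norm)
    (fun u hu => (hd u hu).choose_spec.1.differentiableAt) (fun u hu a => ?_) hu₀
    (sub_eq_zero.2 h₀) u hu
  obtain ⟨T, hT, hTe⟩ := hd u hu
  rw [hT.fderiv]
  set f := l.comp (fderiv ℝ y u) - l (y u) • tchebychev 1 y u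
  refine (T a).opNorm_le_bound (by positivity) fun b => ?_
  rw [hTe]
  have h1 : ‖f (connL 1 y u a b)‖ ≤ ‖f‖ * (‖connL 1 y u‖ * ‖a‖ * ‖b‖) :=
    (f.le_opNorm _).trans (by gcongr; exact (connL 1 y u).le_opNorm₂ a b)
  have h2 : ‖f a * tchebychev 1 y u b‖ ≤ (‖f‖ * ‖a‖) * (‖tchebychev 1 y u‖ * ‖b‖) := by
    rw [norm_mul]
    gcongr
    exacts [f.le_opNorm a, (tchebychev 1 y u).le_opNorm b]
  calc _ ≤ _ := norm_sub_le _ _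
    _ ≤ _ := add_le_add h1 h2
    _ = _ := by ring

/-- With `E` the axis field, the derivative of `y_* E - y` along `a` is `η(a) (y_* E - y)`. So if
`β` vanishes on this vector at one point, it does everywhere. -/
theorem comp_fderiv_axis (β : Ambient n →L[ℝ] ℝ) {u₀ : Coord n} (hu₀ : u₀ ∈ U)
    (h₀ : β (fderiv ℝ y u₀ (axis 1 y u₀)) = β (y u₀)) (hu : u ∈ U) :
    β (fderiv ℝ y u (axis 1 y u)) = β (y u) := by
  rw [← sub_eq_zero]
  have hd : ∀ u ∈ U, ∃ T : Coord n →L[ℝ] ℝ,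
      HasFDerivAt (fun u => β (fderiv ℝ y u (axis 1 y u)) - β (y u)) T u ∧
      ∀ a, T a = tchebychev 1 y u a * (β (fderiv ℝ y u (axis 1 y u)) - β (y u)) := by
    intro u hu
    obtain ⟨T, hT, hTe⟩ := h.hasFDerivAt_comp_fderiv β hu
    refine ⟨_, (hT.clm_apply (h.regular.hasFDerivAt_of_contDiffOn
      h.regular.contDiffOn_axis hu)).sub (h.hasFDerivAt_comp β hu), fun a => ?_⟩
    simp only [sub_apply, add_apply, ContinuousLinearMap.comp_apply,
      ContinuousLinearMap.flip_apply, hTe, h.regular.fderiv_axis h.parallel hu,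
      h.connL_eq hu, h.metricL_axis_right hu, h.tchebychev_axis hu]
    simp only [map_add, map_sub, map_smul, map_neg, smul_eq_mul]
    ring
  refine eq_zero_of_norm_fderiv_le h.convex (κ := fun u => ‖tchebychev 1 y u‖)
    (f := fun u => β (fderiv ℝ y u (axis 1 y u)) - β (y u))
    h.regular.contDiffOn_tchebychev.continuousOn.norm
    (fun u hu => (hd u hu).choose_spec.1.differentiableAt) (fun u hu a => ?_) hu₀
    (sub_eq_zero.2 h₀) u hu
  obtain ⟨T, hT, hTe⟩ := hd u hu
  rw [hT.fderiv, hTe, norm_mul]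
  gcongr
  exact (tchebychev 1 y u).le_opNorm a

/-- A solution of the system satisfied by the functions `β ∘ y` vanishes if its value and its first
derivative vanish at one point. -/
theorem eq_zero_of_hessian {f : Coord n → ℝ} {φ : Coord n → Coord n →L[ℝ] ℝ}
    (hf : ∀ u ∈ U, HasFDerivAt f (φ u) u)
    (hφ : ∀ u ∈ U, ∃ T : Coord n →L[ℝ] Coord n →L[ℝ] ℝ, HasFDerivAt φ T u ∧
      ∀ a b, T a b = φ u (connL 1 y u a b) - metricL 1 y u a b * f u)
    {u₀ : Coord n} (hu₀ : u₀ ∈ U) (hf₀ : f u₀ = 0) (hφ₀ : φ u₀ = 0) (hu : u ∈ U) : f u = 0 := by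
  suffices h0 : (fun u => (f u, φ u)) u = 0 from congrArg Prod.fst h0
  refine eq_zero_of_norm_fderiv_le h.convex
    (κ := fun u => 1 + (‖connL 1 y u‖ + ‖metricL 1 y u‖))
    (continuousOn_const.add (h.regular.contDiffOn_connL.continuousOn.norm.add
      h.regular.contDiffOn_metricL.continuousOn.norm))
    (fun u hu => ((hf u hu).prodMk (hφ u hu).choose_spec.1).differentiableAt)
    (fun u hu a => ?_) hu₀ (by simp [hf₀, hφ₀]) u hu
  obtain ⟨T, hT, hTe⟩ := hφ u hu
  rw [((hf u hu).prodMk hT).fderiv]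
  set N := ‖(f u, φ u)‖
  have hfN : ‖f u‖ ≤ N := norm_fst_le (f u, φ u)
  have hφN : ‖φ u‖ ≤ N := norm_snd_le (f u, φ u)
  have hN : 0 ≤ N := norm_nonneg _
  refine norm_prod_le_iff.2 ⟨?_, ?_⟩
  · calc ‖φ u a‖ ≤ ‖φ u‖ * ‖a‖ := (φ u).le_opNorm a
      _ ≤ N * ‖a‖ := by gcongr
      _ ≤ (1 + (‖connL 1 y u‖ + ‖metricL 1 y u‖)) * ‖a‖ * N := by
        have : 0 ≤ (‖connL 1 y u‖ + ‖metricL 1 y u‖) * ‖a‖ * N := by positivity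
        linarith
  · refine (T a).opNorm_le_bound (by positivity) fun b => ?_
    rw [hTe]
    have h1 : ‖φ u (connL 1 y u a b)‖ ≤ N * (‖connL 1 y u‖ * ‖a‖ * ‖b‖) :=
      ((φ u).le_opNorm _).trans (by gcongr; exact (connL 1 y u).le_opNorm₂ a b)
    have h2 : ‖metricL 1 y u a b * f u‖ ≤ (‖metricL 1 y u‖ * ‖a‖ * ‖b‖) * N := by
      rw [norm_mul]
      gcongr
      exact (metricL 1 y u).le_opNorm₂ a b
    have h3 : 0 ≤ N * (‖a‖ * ‖b‖) := by positivity
    refine (norm_sub_le _ _).trans ((add_le_add h1 h2).trans ?_)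
    linarith

omit h in
/-- The differential of `(β ∘ y) / (l ∘ y)`, written for a functional `l` with
`d(l ∘ y) = (l ∘ y) η`. -/
def quotDeriv (y : Coord n → Ambient n) (l β : Ambient n →L[ℝ] ℝ) (u : Coord n) :
    Coord n →L[ℝ] ℝ :=
  (l (y u))⁻¹ • β.comp (fderiv ℝ y u) - (β (y u) * (l (y u))⁻¹) • tchebychev 1 y u

section Quotient

variable {l β : Ambient n →L[ℝ] ℝ}

omit [NeZero n] in
theorem hasFDerivAt_inv_comp (hu : u ∈ U) (hpos : 0 < l (y u))
    (hl : l.comp (fderiv ℝ y u) = l (y u) • tchebychev 1 y u) :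
    HasFDerivAt (fun u => (l (y u))⁻¹) (-(l (y u))⁻¹ • tchebychev 1 y u) u := by
  have hne := hpos.ne'
  refine ((hasDerivAt_inv hne).comp_hasFDerivAt u (h.hasFDerivAt_comp l hu)).congr_fderiv ?_
  rw [hl, smul_smul]
  congr 1
  field_simp

omit [NeZero n] in
theorem hasFDerivAt_quotient (hu : u ∈ U) (hpos : 0 < l (y u))
    (hl : l.comp (fderiv ℝ y u) = l (y u) • tchebychev 1 y u) :
    HasFDerivAt (fun u => β (y u) * (l (y u))⁻¹) (quotDeriv y l β u) u := by
  refine ((h.hasFDerivAt_comp β hu).mul (h.hasFDerivAt_inv_comp hu hpos hl)).congr_fderiv ?_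
  rw [quotDeriv]
  module

omit [NeZero n] in
theorem quotDeriv_axis (hu : u ∈ U) (hβ : β (fderiv ℝ y u (axis 1 y u)) = β (y u)) :
    quotDeriv y l β u (axis 1 y u) = 0 := by
  simp only [quotDeriv, sub_apply, smul_apply, ContinuousLinearMap.comp_apply, smul_eq_mul, hβ,
    h.tchebychev_axis hu]
  ring

/-- The form `d((β ∘ y) / (l ∘ y))` is parallel for the Levi-Civita connection. -/
theorem hasFDerivAt_quotDeriv (hu : u ∈ U) (hpos : 0 < l (y u))
    (hl : l.comp (fderiv ℝ y u) = l (y u) • tchebychev 1 y u)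
    (hβ : β (fderiv ℝ y u (axis 1 y u)) = β (y u)) :
    ∃ T : Coord n →L[ℝ] Coord n →L[ℝ] ℝ, HasFDerivAt (quotDeriv y l β) T u ∧
      ∀ a b, T a b = quotDeriv y l β u (leviL 1 y u a b) := by
  obtain ⟨T, hT, hTe⟩ := h.hasFDerivAt_comp_fderiv β hu
  refine ⟨_, ((h.hasFDerivAt_inv_comp hu hpos hl).smul hT).sub
    ((h.hasFDerivAt_quotient hu hpos hl).smul (h.regular.hasFDerivAt_of_contDiffOn
      h.regular.contDiffOn_tchebychev hu)), fun a b => ?_⟩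
  simp only [quotDeriv, sub_apply, add_apply, smul_apply, ContinuousLinearMap.smulRight_apply,
    ContinuousLinearMap.comp_apply, smul_eq_mul, hTe,
    h.regular.fderiv_tchebychev h.parallel hu, h.connL_eq hu, map_add, map_sub, map_smul, hβ]
  ring

end Quotient

section Graph

variable {ι : Type*} {s : Finset ι} {l μ : Ambient n →L[ℝ] ℝ} {β : ι → Ambient n →L[ℝ] ℝ}
  {u₀ : Coord n}

/-- The metric is `η ⊗ η + ∑ₖ dwₖ ⊗ dwₖ` with `wₖ = (βₖ ∘ y) / (l ∘ y)`, if this holds at one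
point: both sides are parallel. -/
theorem metricL_eq_sum (hu₀ : u₀ ∈ U) (hpos : ∀ u ∈ U, 0 < l (y u))
    (hl : ∀ u ∈ U, l.comp (fderiv ℝ y u) = l (y u) • tchebychev 1 y u)
    (hβ : ∀ k ∈ s, ∀ u ∈ U, β k (fderiv ℝ y u (axis 1 y u)) = β k (y u))
    (h₀ : ∀ a b, metricL 1 y u₀ a b = tchebychev 1 y u₀ a * tchebychev 1 y u₀ b
      + ∑ k ∈ s, quotDeriv y l (β k) u₀ a * quotDeriv y l (β k) u₀ b)
    (hu : u ∈ U) (a b : Coord n) :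
    metricL 1 y u a b = tchebychev 1 y u a * tchebychev 1 y u b
      + ∑ k ∈ s, quotDeriv y l (β k) u a * quotDeriv y l (β k) u b := by
  have hσ := fun k (hk : k ∈ s) u (hu : u ∈ U) =>
    h.hasFDerivAt_quotDeriv hu (hpos u hu) (hl u hu) (hβ k hk u hu)
  choose! T hT hTe using hσ
  set SR := ContinuousLinearMap.smulRightL ℝ (Coord n) (Coord n →L[ℝ] ℝ) with hSR
  set B : Coord n → Coord n →L[ℝ] Coord n →L[ℝ] ℝ := fun u =>
    metricL 1 y u - SR (tchebychev 1 y u) (tchebychev 1 y u)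
      - ∑ k ∈ s, SR (quotDeriv y l (β k) u) (quotDeriv y l (β k) u) with hB
  have hBe : ∀ u a b, B u a b = metricL 1 y u a b - tchebychev 1 y u a * tchebychev 1 y u b
      - ∑ k ∈ s, quotDeriv y l (β k) u a * quotDeriv y l (β k) u b := fun u a b => by
    simp [hB, hSR]
  have hBd : ∀ u ∈ U, ∃ T : Coord n →L[ℝ] Coord n →L[ℝ] Coord n →L[ℝ] ℝ, HasFDerivAt B T u ∧
      ∀ c a b, T c a b = B u (leviL 1 y u c a) b + B u a (leviL 1 y u c b) := fun u hu => by
    have hSRd : ∀ {τ : Coord n → Coord n →L[ℝ] ℝ} {T : Coord n →L[ℝ] Coord n →L[ℝ] ℝ},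
        HasFDerivAt τ T u → HasFDerivAt (fun u => SR (τ u) (τ u)) _ u := fun hτ =>
      ((SR.hasFDerivAt.comp u hτ).clm_apply hτ)
    refine ⟨_, ((h.regular.hasFDerivAt_of_contDiffOn h.regular.contDiffOn_metricL hu).sub
      (hSRd (h.regular.hasFDerivAt_of_contDiffOn h.regular.contDiffOn_tchebychev hu))).sub
      (HasFDerivAt.fun_sum fun k hk => hSRd (hT k hk u hu)), fun c a b => ?_⟩
    simp only [sub_apply, add_apply, ContinuousLinearMap.comp_apply, sum_apply,
      ContinuousLinearMap.flip_apply, hSR, ContinuousLinearMap.smulRightL_apply_apply,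
      ContinuousLinearMap.smulRight_apply, smul_apply, smul_eq_mul, Function.comp_apply,
      h.regular.fderiv_tchebychev h.parallel hu, h.regular.fderiv_metricL hu, hBe]
    rw [Finset.sum_congr rfl fun k hk => by
      rw [hTe k hk u hu c b, hTe k hk u hu c a]]
    rw [Finset.sum_add_distrib]
    ring
  have hB0 : B u = 0 := by
    refine eq_zero_of_norm_fderiv_le h.convex (κ := fun u => 2 * ‖leviL 1 y u‖)
      (h.regular.contDiffOn_leviL.continuousOn.norm.const_smul (2 : ℝ))
      (fun u hu => (hBd u hu).choose_spec.1.differentiableAt) (fun u hu a => ?_) hu₀ ?_ u hu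
    · obtain ⟨T, hT, hTe⟩ := hBd u hu
      rw [hT.fderiv]
      refine (opNorm_le_of_derivation₂ (hTe a)).trans ?_
      have := (leviL 1 y u).le_opNorm a
      calc 2 * ‖leviL 1 y u a‖ * ‖B u‖ ≤ 2 * (‖leviL 1 y u‖ * ‖a‖) * ‖B u‖ := by gcongr
        _ = _ := by ring
    · ext a b
      rw [hBe, h₀]
      simp
  have hb : B u a b = 0 := by rw [hB0]; rfl
  rw [hBe] at hb
  linarith

/-- With `t = l ∘ y` and `wₖ = (βₖ ∘ y) / t`, the function `t (½ ∑ₖ wₖ² + log t)` and the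
function `μ ∘ y` solve the same linear second order system. If the functionals are adapted to the
frame at `u₀`, the initial data agree as well. -/
theorem graph_equation (hu₀ : u₀ ∈ U) (hpos : ∀ u ∈ U, 0 < l (y u))
    (hl : l (y u₀) = 1) (hdl : ∀ b, l (fderiv ℝ y u₀ b) = tchebychev 1 y u₀ b)
    (hβ : ∀ k ∈ s, β k (y u₀) = 0)
    (hdβ : ∀ k ∈ s, β k (fderiv ℝ y u₀ (axis 1 y u₀)) = 0)
    (hH : ∀ a b, metricL 1 y u₀ a b = tchebychev 1 y u₀ a * tchebychev 1 y u₀ b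
      + ∑ k ∈ s, β k (fderiv ℝ y u₀ a) * β k (fderiv ℝ y u₀ b))
    (hμ : μ (y u₀) = 0) (hdμ : ∀ b, μ (fderiv ℝ y u₀ b) = tchebychev 1 y u₀ b) (hu : u ∈ U) :
    μ (y u) = 1 / (2 * l (y u)) * ∑ k ∈ s, β k (y u) ^ 2 + l (y u) * Real.log (l (y u)) := by
  have hlU : ∀ u ∈ U, l.comp (fderiv ℝ y u) = l (y u) • tchebychev 1 y u := fun u hu =>
    h.comp_fderiv_eq_smul l hu₀ (by ext b; simp [hl, hdl]) hu
  have hβU : ∀ k ∈ s, ∀ u ∈ U, β k (fderiv ℝ y u (axis 1 y u)) = β k (y u) := fun k hk u hu =>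
    h.comp_fderiv_axis (β k) hu₀ (by rw [hβ k hk, hdβ k hk]) hu
  have hsum : ∀ u ∈ U, ∀ a b, metricL 1 y u a b = tchebychev 1 y u a * tchebychev 1 y u b
      + ∑ k ∈ s, quotDeriv y l (β k) u a * quotDeriv y l (β k) u b := fun u hu =>
    h.metricL_eq_sum hu₀ hpos hlU hβU (fun a b => by
      rw [hH]
      congr 1
      exact Finset.sum_congr rfl fun k hk => by simp [quotDeriv, hl, hβ k hk]) hu
  set η := tchebychev 1 y with hη
  have ht : ∀ u ∈ U, HasFDerivAt (fun u => l (y u)) (l (y u) • η u) u := fun u hu => by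
    rw [← hlU u hu]
    exact h.hasFDerivAt_comp l hu
  have hηd : ∀ u ∈ U, HasFDerivAt η (fderiv ℝ η u) u := fun u hu =>
    h.regular.hasFDerivAt_of_contDiffOn h.regular.contDiffOn_tchebychev hu
  have hηp : ∀ u ∈ U, ∀ a b, fderiv ℝ η u a b = η u (leviL 1 y u a b) := fun u hu =>
    h.regular.fderiv_tchebychev h.parallel hu
  set w : ι → Coord n → ℝ := fun k u => β k (y u) * (l (y u))⁻¹ with hw
  set σ : ι → Coord n → Coord n →L[ℝ] ℝ := fun k => quotDeriv y l (β k) with hσ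
  have hwd : ∀ k, ∀ u ∈ U, HasFDerivAt (w k) (σ k u) u := fun k u hu =>
    h.hasFDerivAt_quotient hu (hpos u hu) (hlU u hu)
  have hσd := fun k (hk : k ∈ s) u (hu : u ∈ U) =>
    h.hasFDerivAt_quotDeriv hu (hpos u hu) (hlU u hu) (hβU k hk u hu)
  choose! Tσ hTσ hTσe using hσd
  -- `q` is the differential of `Q = ½ ∑ₖ wₖ² + log t`; its covariant derivative is `h - η ⊗ η`
  set Q : Coord n → ℝ := fun u => ∑ k ∈ s, w k u ^ 2 / 2 + Real.log (l (y u)) with hQ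
  set q : Coord n → Coord n →L[ℝ] ℝ := fun u => ∑ k ∈ s, w k u • σ k u + η u with hq
  have hQd : ∀ u ∈ U, HasFDerivAt Q (q u) u := fun u hu => by
    have hne := (hpos u hu).ne'
    have h1 : HasFDerivAt (fun u => Real.log (l (y u))) (η u) u := by
      refine ((ht u hu).log hne).congr_fderiv ?_
      rw [smul_smul, inv_mul_cancel₀ hne, one_smul]
    refine HasFDerivAt.add (HasFDerivAt.fun_sum fun k hk => ?_) h1
    simp only [div_eq_mul_inv]
    refine (((hwd k u hu).pow 2).mul_const (2⁻¹ : ℝ)).congr_fderiv ?_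
    rw [smul_smul]
    congr 1
    simp
  have hqd : ∀ u ∈ U, ∃ T : Coord n →L[ℝ] Coord n →L[ℝ] ℝ, HasFDerivAt q T u ∧
      ∀ a b, T a b = metricL 1 y u a b - η u a * η u b + q u (leviL 1 y u a b) := fun u hu => by
    refine ⟨_, (HasFDerivAt.fun_sum fun k hk => (hwd k u hu).smul (hTσ k hk u hu)).add (hηd u hu),
      fun a b => ?_⟩
    have hb := hsum u hu a b
    simp only [sum_apply, add_apply, smul_apply, ContinuousLinearMap.smulRight_apply,
      smul_eq_mul, hηp u hu, hq, Finset.sum_add_distrib]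
    rw [Finset.sum_congr rfl fun k hk => by rw [hTσe k hk u hu a b]]
    linarith
  have hqE : ∀ u ∈ U, q u (axis 1 y u) = 1 := fun u hu => by
    simp only [hq, sum_apply, add_apply, smul_apply, smul_eq_mul]
    rw [Finset.sum_eq_zero fun k hk => by rw [h.quotDeriv_axis hu (hβU k hk u hu), mul_zero], zero_add,
      h.tchebychev_axis hu]
  have hQ0 : Q u₀ = 0 := by
    simp only [hQ, hl, Real.log_one, add_zero]
    exact Finset.sum_eq_zero fun k hk => by simp [hw, hβ k hk]
  have hq0 : q u₀ = η u₀ := by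
    simp only [hq]
    rw [Finset.sum_eq_zero fun k hk => by simp [hw, hβ k hk], zero_add]
  have key := h.eq_zero_of_hessian (f := fun u => μ (y u) - l (y u) * Q u)
    (φ := fun u => μ.comp (fderiv ℝ y u) - (l (y u) • q u + Q u • l (y u) • η u))
    (fun u hu => (h.hasFDerivAt_comp μ hu).sub ((ht u hu).mul (hQd u hu)))
    (fun u hu => by
      obtain ⟨T, hT, hTe⟩ := h.hasFDerivAt_comp_fderiv μ hu
      obtain ⟨S, hS, hSe⟩ := hqd u hu
      refine ⟨_, hT.sub (((ht u hu).smul hS).add ((hQd u hu).smul ((ht u hu).smul (hηd u hu)))),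
        fun a b => ?_⟩
      have e1 : η u (connL 1 y u a b) = η u (leviL 1 y u a b) + metricL 1 y u a b
          + η u a * η u b := by
        rw [h.connL_eq hu]
        simp only [map_add, map_sub, map_smul, smul_eq_mul, h.tchebychev_axis hu, hη]
        ring
      have e2 : q u (connL 1 y u a b) = q u (leviL 1 y u a b) + metricL 1 y u a b
          + η u a * q u b + η u b * q u a - η u a * η u b := by
        rw [h.connL_eq hu]
        simp only [map_add, map_sub, map_smul, smul_eq_mul, hqE u hu, hη]
        ring
      simp only [sub_apply, add_apply, smul_apply, ContinuousLinearMap.smulRight_apply,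
        ContinuousLinearMap.comp_apply, smul_eq_mul, hTe, hSe, hηp u hu, e1, e2]
      ring)
    hu₀ (by simp [hμ, hQ0]) (by ext b; simp [hdμ, hQ0, hq0, hl]) hu
  rw [sub_eq_zero.1 key]
  have hne := (hpos u hu).ne'
  simp only [hQ, hw, mul_add, Finset.mul_sum]
  congr 1
  refine Finset.sum_congr rfl fun k _ => ?_
  field_simp

end Graph

end IsModelOn

end Model

/-! ### Coordinates and the canonical graph -/

section Coframe

variable {n : ℕ} {ε : ℝ} {y : Coord n → Ambient n} {U : Set (Coord n)} {u : Coord n}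

namespace IsRegularOn

open scoped MatrixOrder in
theorem exists_metricL_eq_inner (h : IsRegularOn ε y U) (hu : u ∈ U) :
    ∃ T : Coord n →ₗ[ℝ] Coord n, ∀ a b, metricL ε y u a b = inner ℝ (T a) (T b) := by
  obtain ⟨S, hS⟩ := CStarAlgebra.nonneg_iff_eq_star_mul_self.1 (h.posDef u hu).posSemidef.nonneg
  refine ⟨Matrix.toLpLin 2 2 S, fun a b => ?_⟩
  rw [metricL_eq_dotProduct, hS, ← Matrix.mulVec_mulVec, Matrix.dotProduct_mulVec,
    Matrix.star_eq_conjTranspose, Matrix.vecMul_conjTranspose, dotProduct_comm]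
  simp [EuclideanSpace.inner_eq_star_dotProduct]

/-- A dual orthonormal coframe of the metric whose first member is `h(e, ·)`. -/
theorem exists_coframe [NeZero n] (h : IsRegularOn ε y U) (hu : u ∈ U) {e : Coord n}
    (he : metricL ε y u e e = 1) :
    ∃ β : Fin n → Coord n →L[ℝ] ℝ, β 0 = metricL ε y u e ∧ (∀ k, k ≠ 0 → β k e = 0) ∧
      ∀ a b, metricL ε y u a b = ∑ k, β k a * β k b := by
  obtain ⟨T, hT⟩ := h.exists_metricL_eq_inner hu
  have hon : Orthonormal ℝ (({0} : Set (Fin n)).domRestrict fun _ => T e) := by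
    refine ⟨fun i => ?_, fun i j hij => (hij (Subsingleton.elim _ _)).elim⟩
    have h1 := hT e e
    rw [he, real_inner_self_eq_norm_sq] at h1
    exact (pow_eq_one_iff_of_nonneg (norm_nonneg _) two_ne_zero).1 h1.symm
  obtain ⟨b, hb⟩ := hon.exists_orthonormalBasis_extension_of_card_eq (by simp)
  have hb0 : b 0 = T e := hb 0 rfl
  refine ⟨fun k => LinearMap.toContinuousLinearMap ((innerₛₗ ℝ (b k)).comp T), ?_, ?_, ?_⟩
  · ext a
    simp [hb0, hT]
  · intro k hk
    have := b.orthonormal.2 hk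
    simpa [← hb0] using this
  · intro v w
    rw [hT, ← b.sum_inner_mul_inner]
    refine Finset.sum_congr rfl fun k _ => ?_
    simp [real_inner_comm]

/-- Linear functionals of the ambient space can be prescribed on the tangent space and on the
position vector. -/
theorem exists_functional [NeZero n] (h : IsRegularOn 1 y U) (hu : u ∈ U) (ρ : Coord n →L[ℝ] ℝ)
    (c : ℝ) : ∃ β : Ambient n →L[ℝ] ℝ, (∀ b, β (fderiv ℝ y u b) = ρ b) ∧ β (y u) = c := by
  obtain ⟨Φ, hΦ⟩ := h.frame_isInvertible hu
  have h1 : ∀ b s, Φ.symm (fderiv ℝ y u b + s • (-(1 : ℝ) • y u)) = (b, s) := fun b s => by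
    rw [← frame_apply, ← hΦ]
    exact Φ.symm_apply_apply _
  refine ⟨(ρ.coprod (ContinuousLinearMap.toSpanSingleton ℝ (-c))).comp
    (Φ.symm : Ambient n →L[ℝ] Coord n × ℝ), fun b => ?_, ?_⟩
  · have := h1 b 0
    rw [zero_smul, add_zero] at this
    simp [this]
  · have := h1 0 (-1)
    rw [map_zero, zero_add, smul_smul, neg_mul_neg, one_mul, one_smul] at this
    simp [this]

theorem exists_eq_fderiv_add_smul [NeZero n] (h : IsRegularOn 1 y U) (hu : u ∈ U)
    (z : Ambient n) : ∃ b : Coord n, ∃ s : ℝ, z = fderiv ℝ y u b + s • y u := by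
  obtain ⟨⟨b, s⟩, hz⟩ := (h.frame_isInvertible hu).surjective z
  refine ⟨b, -s, ?_⟩
  rw [← hz, frame_apply]
  simp

end IsRegularOn

/-- The inverse function theorem with a smooth inverse on the whole target. -/
theorem exists_openPartialHomeomorph {E : Type*} [NormedAddCommGroup E] [NormedSpace ℝ E]
    [FiniteDimensional ℝ E] {U : Set E} (hU : IsOpen U) {θ : E → E} (hθ : ContDiffOn ℝ ∞ θ U)
    {u : E} (hu : u ∈ U) (hinj : ∀ v, fderiv ℝ θ u v = 0 → v = 0) :
    ∃ g : OpenPartialHomeomorph E E, ⇑g = θ ∧ u ∈ g.source ∧ g.source ⊆ U ∧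
      ContDiffOn ℝ ∞ g.symm g.target := by
  have hat : ∀ u ∈ U, ContDiffAt ℝ ∞ θ u := fun u hu => hθ.contDiffAt (hU.mem_nhds hu)
  have hd : ∀ u ∈ U, HasFDerivAt θ (fderiv ℝ θ u) u := fun u hu =>
    ((hat u hu).differentiableAt (by simp)).hasFDerivAt
  set V : Set E := U ∩ fderiv ℝ θ ⁻¹' Set.range ((↑) : (E ≃L[ℝ] E) → E →L[ℝ] E) with hV
  have hVo : IsOpen V := ((hθ.fderiv_of_isOpen (m := ∞) hU (by simp)).continuousOn).isOpen_inter_preimage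
    hU ContinuousLinearEquiv.isOpen
  have hi : Function.Injective (fderiv ℝ θ u).toLinearMap :=
    (injective_iff_map_eq_zero _).2 hinj
  set Θ : E ≃L[ℝ] E := (LinearEquiv.ofInjectiveEndo (fderiv ℝ θ u).toLinearMap
    hi).toContinuousLinearEquiv with hΘ
  have hΘe : (Θ : E →L[ℝ] E) = fderiv ℝ θ u := by ext v; rfl
  have huV : u ∈ V := ⟨hu, Θ, hΘe⟩
  have hd' : HasFDerivAt θ (Θ : E →L[ℝ] E) u := by rw [hΘe]; exact hd u hu
  set g := ((hat u hu).toOpenPartialHomeomorph θ hd' (by simp)).restrOpen V hVo with hg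
  have hge : ⇑g = θ := rfl
  have hgs : g.source ⊆ V := by
    rw [hg, OpenPartialHomeomorph.restrOpen_source]
    exact Set.inter_subset_right
  refine ⟨g, hge, ?_, hgs.trans Set.inter_subset_left, fun a ha => ?_⟩
  · rw [hg, OpenPartialHomeomorph.restrOpen_source]
    exact ⟨(hat u hu).mem_toOpenPartialHomeomorph_source hd' (by simp), huV⟩
  · obtain ⟨haU, ψ, hψ⟩ := hgs (g.map_target ha)
    refine (g.contDiffAt_symm ha (f₀' := ψ) ?_ ?_).contDiffWithinAt
    · rw [hψ, hge]; exact hd _ haU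
    · rw [hge]; exact hat _ haU

/-- Functionals adapted to an orthonormal coframe at `u₀` give both the coordinates and the linear map
that identify `y` with the canonical graph. -/
theorem IsModelOn.exists_graph_chart [NeZero n] (h : IsModelOn y U) {u₀ : Coord n}
    (hu₀ : u₀ ∈ U) :
    ∃ A : Ambient n ≃ₗ[ℝ] Ambient n, ∃ g : OpenPartialHomeomorph (Coord n) (Coord n),
      u₀ ∈ g.source ∧ g.source ⊆ U ∧ ContDiffOn ℝ ∞ g g.source ∧ ContDiffOn ℝ ∞ g.symm g.target ∧
      g.target ⊆ canonicalDomain n ∧ ∀ u ∈ g.source, A (y u) = canonicalGraph (g u) := by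
  have hr := h.regular
  obtain ⟨σ, hσ0, hσE, hσ⟩ := hr.exists_coframe hu₀ (h.isAxis u₀ hu₀).1
  have hσ0' : ∀ b, σ 0 b = tchebychev 1 y u₀ b := fun b => by
    rw [hσ0, hr.metricL_axis hu₀]
  -- the values at `y u₀` make the first coordinate `1` and the others `0` there, so that the graph
  -- function `t (½ ∑ₖ (yₖ / t)² + log t)` has value `0` and differential `η` at `u₀`, as `μ ∘ y` does
  choose! β hβd hβ using fun k : Fin n =>
    hr.exists_functional hu₀ (σ k) (if k = 0 then 1 else 0)
  obtain ⟨μ, hμd, hμ⟩ := hr.exists_functional hu₀ (tchebychev 1 y u₀) 0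
  have hβ0 : β 0 (y u₀) = 1 := by simp [hβ]
  -- a smaller convex neighbourhood on which the first coordinate is positive
  have hopen : IsOpen (U ∩ (fun u => β 0 (y u)) ⁻¹' Set.Ioi 0) :=
    ((β 0).continuous.comp_continuousOn hr.smooth.continuousOn).isOpen_inter_preimage
      hr.isOpen isOpen_Ioi
  obtain ⟨r, hr0, hball⟩ := Metric.isOpen_iff.1 hopen u₀ ⟨hu₀, by simp [hβ0]⟩
  have hW := h.mono Metric.isOpen_ball (convex_ball u₀ r)
    (hball.trans Set.inter_subset_left)
  have hgraph : ∀ u ∈ Metric.ball u₀ r, μ (y u) = 1 / (2 * β 0 (y u))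
      * ∑ k ∈ Finset.univ.erase 0, β k (y u) ^ 2 + β 0 (y u) * Real.log (β 0 (y u)) :=
    fun u hu => hW.graph_equation (s := Finset.univ.erase 0) (l := β 0) (μ := μ) (β := β)
      (Metric.mem_ball_self hr0) (fun u hu => (hball hu).2) hβ0 (fun b => by rw [hβd, hσ0'])
      (fun k hk => by simp [hβ, Finset.ne_of_mem_erase hk])
      (fun k hk => by rw [hβd, hσE k (Finset.ne_of_mem_erase hk)])
      (fun a b => by
        rw [hσ, ← Finset.add_sum_erase _ _ (Finset.mem_univ 0)]
        simp only [hβd, hσ0'])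
      hμ hμd hu
  set P : Ambient n →L[ℝ] Coord n :=
    ((EuclideanSpace.equiv (Fin n) ℝ).symm : (Fin n → ℝ) →L[ℝ] Coord n).comp
      (ContinuousLinearMap.pi β) with hP
  have hPe : ∀ z k, P z k = β k z := fun z k => rfl
  have hdef : ∀ b, (∀ k, σ k b = 0) → b = 0 := fun b hb => by
    by_contra hne
    have := hr.metricL_pos hu₀ hne
    rw [hσ] at this
    simp [hb] at this
  obtain ⟨g, hge, hg0, hgs, hgsymm⟩ := exists_openPartialHomeomorph Metric.isOpen_ball
    (θ := P ∘ y) (P.contDiff.comp_contDiffOn hW.regular.smooth)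
    (Metric.mem_ball_self hr0) (fun v hv => hdef v fun k => by
      rw [(P.hasFDerivAt.comp u₀ (hr.hasFDerivAt hu₀)).fderiv] at hv
      rw [← hβd, ← hPe]
      exact congrArg (fun w : Coord n => w k) hv)
  set A₀ : Ambient n →ₗ[ℝ] Ambient n :=
    LinearMap.pi (Fin.snoc (α := fun _ => Ambient n →ₗ[ℝ] ℝ) (fun k => (β k).toLinearMap)
      μ.toLinearMap) with hA₀
  have hAc : ∀ z (k : Fin n), A₀ z k.castSucc = β k z := fun z k => by simp [hA₀]
  have hAl : ∀ z, A₀ z (Fin.last n) = μ z := fun z => by simp [hA₀]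
  have hAinj : Function.Injective A₀ := by
    refine (injective_iff_map_eq_zero _).2 fun z hz => ?_
    obtain ⟨b, s, rfl⟩ := hr.exists_eq_fderiv_add_smul hu₀ z
    have e1 : ∀ k, σ k b + s * (if k = 0 then 1 else 0) = 0 := fun k => by
      have := hAc (fderiv ℝ y u₀ b + s • y u₀) k
      rw [hz, map_add, map_smul, hβd, hβ] at this
      exact this.symm
    have e2 : tchebychev 1 y u₀ b = 0 := by
      have := hAl (fderiv ℝ y u₀ b + s • y u₀)
      rw [hz, map_add, map_smul, hμd, hμ, smul_zero, add_zero] at this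
      exact this.symm
    have e3 : s = 0 := by
      have := e1 0
      rwa [hσ0', e2, if_pos rfl, mul_one, zero_add] at this
    have e4 : b = 0 := hdef b fun k => by simpa [e3] using e1 k
    simp [e3, e4]
  refine ⟨LinearEquiv.ofInjectiveEndo A₀ hAinj, g, hg0,
    hgs.trans (hball.trans Set.inter_subset_left), ?_, hgsymm, ?_, fun u hu => ?_⟩
  · rw [hge]
    exact (P.contDiff.comp_contDiffOn hW.regular.smooth).mono hgs
  · intro t ht
    have h1 := (hball (hgs (g.map_target ht))).2
    have h2 := g.right_inv ht
    rw [hge] at h2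
    rw [canonicalDomain, Set.mem_ofPred_eq, ← h2, Function.comp_apply, hPe]
    exact h1
  · rw [hge]
    change A₀ (y u) = _
    funext j
    induction j using Fin.lastCases with
    | last => simp only [hAl, canonicalGraph, Fin.snoc_last, Function.comp_apply, hPe,
        hgraph u (hgs hu)]
    | cast k => simp only [hAc, canonicalGraph, Fin.snoc_castSucc, Function.comp_apply, hPe]

end Coframe

/-! ### From coordinate domains to the manifold -/

section Global

variable {n : ℕ} {ε : ℝ} {M : Type*} [TopologicalSpace M] [ChartedSpace (Coord n) M]
  {x : M → Ambient n}

theorem IsLocallyStronglyConvex.isRegularOn (hx : IsLocallyStronglyConvex ε x)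
    {φ : OpenPartialHomeomorph M (Coord n)} (hφ : φ ∈ IsManifold.maximalAtlas (𝓡 n) ∞ M) :
    IsRegularOn ε (x ∘ φ.symm) φ.target where
  isOpen := φ.open_target
  smooth := contMDiffOn_iff_contDiffOn.1
    (hx.smooth.comp_contMDiffOn (contMDiffOn_symm_of_mem_maximalAtlas hφ))
  posDef := hx.posDef φ hφ

/-- The cubic form has an axis at the point `q`, in some smooth coordinate system around `q`. -/
def HasAxisAt (ε : ℝ) (x : M → Ambient n) (q : M) : Prop :=
  ∃ φ ∈ IsManifold.maximalAtlas (𝓡 n) ∞ M, q ∈ φ.source ∧ ∃ e, IsAxis ε (x ∘ φ.symm) (φ q) e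

theorem HasAxisAt.exists_isAxis [NeZero n] (hx : IsLocallyStronglyConvex ε x) {q : M}
    (hq : HasAxisAt ε x q) {ψ : OpenPartialHomeomorph M (Coord n)}
    (hψ : ψ ∈ IsManifold.maximalAtlas (𝓡 n) ∞ M) (hqψ : q ∈ ψ.source) :
    ∃ e, IsAxis ε (x ∘ ψ.symm) (ψ q) e := by
  obtain ⟨φ, hφ, hqφ, hax⟩ := hq
  have hmem : ψ q ∈ (ψ.symm.trans φ).source := by simp [hqψ, hqφ]
  have hsub : (ψ.symm.trans φ).source ⊆ ψ.target := fun u hu => by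
    rw [OpenPartialHomeomorph.trans_source] at hu
    exact hu.1
  have hsub' : ∀ u ∈ (ψ.symm.trans φ).source, ψ.symm u ∈ φ.source := fun u hu => by
    rw [OpenPartialHomeomorph.trans_source] at hu
    exact hu.2
  refine ((hx.isRegularOn hψ).mono (ψ.symm.trans φ).open_source hsub).exists_isAxis_comp
    (hx.isRegularOn hφ) (θ := φ ∘ ψ.symm) ?_ (fun u hu => φ.map_source (hsub' u hu))
    (fun u hu => ?_) hmem ?_
  · exact contMDiffOn_iff_contDiffOn.1 ((contMDiffOn_of_mem_maximalAtlas hφ).comp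
      ((contMDiffOn_symm_of_mem_maximalAtlas hψ).mono hsub) hsub')
  · simp [φ.left_inv (hsub' u hu)]
  · simpa [ψ.left_inv hqψ] using hax

/-- Around every point there is a coordinate domain on which an axis at one point gives axes
everywhere. -/
theorem IsLocallyStronglyConvex.exists_isModelOn [NeZero n] (hx : IsLocallyStronglyConvex 1 x)
    (hC : HasParallelCubicForm 1 x) {ψ : OpenPartialHomeomorph M (Coord n)}
    (hψ : ψ ∈ IsManifold.maximalAtlas (𝓡 n) ∞ M) {q : M} (hq : q ∈ ψ.source) :
    ∃ U ⊆ ψ.target, IsOpen U ∧ ψ q ∈ U ∧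
      ∀ q' ∈ ψ.source, ψ q' ∈ U → HasAxisAt 1 x q' → IsModelOn (x ∘ ψ.symm) U := by
  obtain ⟨r, hr, hball⟩ := Metric.isOpen_iff.1 ψ.open_target _ (ψ.map_source hq)
  have hreg := (hx.isRegularOn hψ).mono Metric.isOpen_ball hball
  have hpar : ∀ u ∈ Metric.ball (ψ q) r, ∀ a v w z,
      covDerivCubicForm 1 (x ∘ ψ.symm) u a v w z = 0 := fun u hu => hC ψ hψ u (hball hu)
  exact ⟨Metric.ball (ψ q) r, hball, Metric.isOpen_ball, Metric.mem_ball_self hr,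
    fun q' hq' hU hax => ⟨hreg, convex_ball _ _, hpar, fun u hu =>
      hreg.isAxis_of_convex hpar (convex_ball _ _) hU (hax.exists_isAxis hx hψ hq') hu⟩⟩

theorem isClopen_hasAxisAt [NeZero n] [IsManifold (𝓡 n) ∞ M] (hx : IsLocallyStronglyConvex 1 x)
    (hC : HasParallelCubicForm 1 x) : IsClopen {q | HasAxisAt 1 x q} := by
  have key : ∀ q : M, ∃ V : Set M, IsOpen V ∧ q ∈ V ∧
      ∀ q' ∈ V, ∀ q'' ∈ V, HasAxisAt 1 x q' → HasAxisAt 1 x q'' := by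
    intro q
    have hψ := IsManifold.chart_mem_maximalAtlas (I := 𝓡 n) (n := ∞) q
    obtain ⟨U, hUt, hU, hqU, hmod⟩ := hx.exists_isModelOn hC hψ (mem_chart_source (Coord n) q)
    exact ⟨_, (chartAt (Coord n) q).isOpen_inter_preimage hU,
      ⟨mem_chart_source (Coord n) q, hqU⟩, fun q' hq' q'' hq'' hax =>
        ⟨_, hψ, hq''.1, _, (hmod q' hq'.1 hq'.2 hax).isAxis _ hq''.2⟩⟩
  constructor
  · rw [← isOpen_compl_iff, isOpen_iff_mem_nhds]
    intro q hq
    obtain ⟨V, hV, hqV, hVq⟩ := key q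
    filter_upwards [hV.mem_nhds hqV] with q' hq' hax using hq (hVq q' hq' q hqV hax)
  · rw [isOpen_iff_mem_nhds]
    intro q hq
    obtain ⟨V, hV, hqV, hVq⟩ := key q
    filter_upwards [hV.mem_nhds hqV] with q' hq' using hVq q hqV q' hq' hq

theorem HasAxisAt.centroaffinelyEquivalentNear [NeZero n] [IsManifold (𝓡 n) ∞ M]
    (hx : IsLocallyStronglyConvex 1 x) (hC : HasParallelCubicForm 1 x) {q : M}
    (hq : HasAxisAt 1 x q) :
    CentroaffinelyEquivalentNear x q canonicalGraph (canonicalDomain n) := by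
  set ψ := chartAt (Coord n) q
  have hψ : ψ ∈ IsManifold.maximalAtlas (𝓡 n) ∞ M := IsManifold.chart_mem_maximalAtlas q
  have hqψ : q ∈ ψ.source := mem_chart_source (Coord n) q
  obtain ⟨U, hUt, hU, hqU, hmod⟩ := hx.exists_isModelOn hC hψ hqψ
  obtain ⟨A, g, hqg, hgU, hg, hgsymm, hgt, hA⟩ :=
    (hmod q hqψ hqU hq).exists_graph_chart hqU
  have hs : ∀ p ∈ (ψ.trans g).source, p ∈ ψ.source ∧ ψ p ∈ g.source := fun p hp => by
    rwa [OpenPartialHomeomorph.trans_source] at hp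
  have ht : ∀ t ∈ (ψ.trans g).target, t ∈ g.target ∧ g.symm t ∈ ψ.target := fun t ht => by
    rwa [OpenPartialHomeomorph.trans_target] at ht
  refine ⟨A, ψ.trans g, OpenPartialHomeomorph.mem_maximalAtlas_of_contMDiffOn _ ?_ ?_, ?_,
    fun t h => hgt (ht t h).1, fun p hp => ?_⟩
  · exact (contMDiffOn_iff_contDiffOn.2 hg).comp
      ((contMDiffOn_of_mem_maximalAtlas hψ).mono fun p hp => (hs p hp).1) fun p hp => (hs p hp).2
  · exact (contMDiffOn_symm_of_mem_maximalAtlas hψ).comp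
      ((contMDiffOn_iff_contDiffOn.2 hgsymm).mono fun t h => (ht t h).1) fun t h => (ht t h).2
  · simp [hqψ, hqg]
  · have := hA (ψ p) (hs p hp).2
    rwa [Function.comp_apply, ψ.left_inv (hs p hp).1] at this

theorem CaseB.eq_one_and_hasAxisAt [NeZero n] (hx : IsLocallyStronglyConvex ε x) {p : M}
    (hp : CaseB ε x p) : ε = 1 ∧ HasAxisAt ε x p := by
  obtain ⟨φ, hφ, hpφ, e, lam, he, h0, hi⟩ := hp
  have hε : ε = 1 := hx.sign.resolve_right fun h => by
    rw [h] at h0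
    nlinarith [sq_nonneg (lam 0)]
  have hr := hx.isRegularOn hφ
  have hu := φ.map_source hpφ
  -- the cubic `f` is odd, so its maximum `lam 0` is non-negative
  have hnn : 0 ≤ lam 0 := by
    have he0 : metricL ε (x ∘ φ.symm) (φ p) (e 0) (e 0) = 1 := by
      rw [metricL_apply, he.orthonormal, if_pos rfl]
    have h1 := he.isMax (-e 0)
    have h2 := he.eigen 0
    simp only [← metricL_apply, hr.diffTensor_eq hu] at h1 h2
    simp only [map_neg, neg_apply, neg_neg, h2, map_smul, smul_apply, he0, smul_eq_mul,
      mul_one] at h1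
    linarith [h1 trivial]
  have h2 : lam 0 = 2 := by
    rw [hε] at h0
    nlinarith
  exact ⟨hε, φ, hφ, hpφ, _, hr.isAxis_of_isTypicalBasis hu he h2 fun i h => by
    rw [hi i h, h2]; norm_num⟩

end Global

end Centroaffine

end

theorem theorem5p1 (n : ℕ) [n.AtLeastTwo]
    {M : Type*} [TopologicalSpace M] [ChartedSpace (Centroaffine.Coord n) M]
    [IsManifold (𝓡 n) ∞ M]
    (ε : ℝ) (x : M → Centroaffine.Ambient n)
    (hx : Centroaffine.IsLocallyStronglyConvex ε x)
    (hC : Centroaffine.HasParallelCubicForm ε x)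
    (p : M) (hp : Centroaffine.CaseB ε x p) :
    ∀ q ∈ connectedComponent p,
      Centroaffine.CentroaffinelyEquivalentNear x q
        Centroaffine.canonicalGraph (Centroaffine.canonicalDomain n) := by
  obtain ⟨rfl, hax⟩ := hp.eq_one_and_hasAxisAt hx
  intro q hq
  have hq' : Centroaffine.HasAxisAt 1 x q :=
    (Centroaffine.isClopen_hasAxisAt hx hC).connectedComponent_subset hax hq
  exact hq'.centroaffinelyEquivalentNear hx hC
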